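/- Let $d\ge 1$, let $p$ be a probability distribution on $\mathbb{Z}^d$ whose support generates the group $\mathbb{Z}^d$ (for instance a nearest-neighbour jump distribution whose support spans $\mathbb{Z}^d$), and let $0<\lambda<\infty$. In the Activated Random Walk model on $\mathbb{Z}^d$ with jump distribution $p$ and sleep rate $\lambda$, each active particle jumps at rate $1$, from $x$ to $x+z$ with probability $p(z)$, and tries to fall asleep at rate $\lambda$, which succeeds exactly when it is alone at its site; a sleeping particle does not move, and becomes active as soon as another particle is at its site. For an initial configuration of law $\nu$ with finite mean number of particles per site, the process $(\eta_t)_{t\ge 0}$ is the limit, as finite boxes increase to $\mathbb{Z}^d$, of the systems started from the restrictions of $\eta_0$ to these boxes; it is constructed from i.i.d. stacks of instructions at the sites (sleep with probability $\frac{\lambda}{1+\lambda}$, jump by $z$ with probability $\frac{p(z)}{1+\lambda}$) and independent Poisson clocks of intensity $1+\lambda$ at the sites, where the clock of a site runs at a speed equal to the number of active particles there and each ring uses up the next instruction of the stack. The system *fixates* if, for each site, there is a time after which the site is always vacant or occupied by a single sleeping particle. It *stays active* if each site has at least one active particle at arbitrarily large times. A number $\zeta_c$ is the *critical density* for $d$,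 $p$, $\lambda$ if for every translation-ergodic law $\nu$ on configurations of active particles only, with finite average density $\zeta=\int|\eta(0)|\,\nu(d\eta)$, the probability that the system started from $\nu$ stays active is $0$ if $\zeta<\zeta_c$ and $1$ if $\zeta>\zeta_c$. **Theorem.** For any such $d$, $p$ and $\lambda$, $$\zeta_c\ \ge\ \frac{\lambda}{1+\lambda}.$$ Moreover, for every translation-ergodic law $\nu$ on configurations of active particles only, with average density $\zeta<\frac{\lambda}{1+\lambda}$, the system started from $\nu$ almost surely fixates. -/

import Mathlib

open MeasureTheory ProbabilityTheory Filter Topology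
open scoped NNReal ENNReal

noncomputable section

namespace ARW

/-- Sites of the lattice `ℤ^d`. -/
abbrev Site (d : ℕ) : Type := Fin d → ℤ

/-- The set `ℕ₀ ∪ {𝔰}` of possible states of one site: `active n` means `n` active particles
(so `active 0` is a vacant site), and `sleeping` means exactly one sleeping particle. -/
inductive Occ : Type
  | active (n : ℕ) : Occ
  | sleeping : Occ

namespace Occ

instance : MeasurableSpace Occ := ⊤

/-- Number of particles, whatever their state. -/
def card : Occ → ℕ
  | active n => n
  | sleeping => 1

/-- Number of active particles. -/
def numActive : Occ → ℕ
  | active n => n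
  | sleeping => 0

/-- A site is stable when it is vacant or holds one sleeping particle. -/
def Stable (a : Occ) : Prop := a = active 0 ∨ a = sleeping

/-- Arrival of a particle; it wakes up a sleeping particle (`𝔰 + 1 = 2`). -/
def add : Occ → Occ
  | active n => active (n + 1)
  | sleeping => active 2

/-- Departure of a particle (only ever used at sites with an active particle). -/
def remove : Occ → Occ
  | active n => active (n - 1)
  | sleeping => active 0

/-- A particle tries to fall asleep: it succeeds exactly when it is alone. -/
def trySleep : Occ → Occ
  | active n => if n = 1 then sleeping else active n
  | sleeping => sleeping

end Occ

/-- Configurations of active and sleeping particles on `ℤ^d`. -/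
abbrev Config (d : ℕ) : Type := Site d → Occ

/-- An instruction: try to sleep, or jump by the displacement `z`. -/
inductive Instr (d : ℕ) : Type
  | sleep : Instr d
  | jump (z : Site d) : Instr d

instance (d : ℕ) : MeasurableSpace (Instr d) := ⊤

/-- The result of carrying out, at the site `x`, a given instruction. -/
def topple {d : ℕ} (x : Site d) (i : Instr d) (η : Config d) : Config d :=
  match i with
  | Instr.sleep => Function.update η x (η x).trySleep
  | Instr.jump z =>
    let η' := Function.update η x (η x).remove
    Function.update η' (x + z) (η' (x + z)).add

/-! ### Evolution from a finite configuration, with given stacks of instructions and clocks -/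

/-- The state of the evolution just after some toppling: the configuration, the number of topplings
performed so far at each site, the local time of each site, and the current time. -/
structure State (d : ℕ) where
  config : Config d
  odometer : Site d → ℕ
  localTime : Site d → ℝ
  time : ℝ≥0∞

/-- The `n`-th ring `T_n(x) = E_0(x) + ⋯ + E_{n-1}(x)` of the clock of `x`, in the local time of
`x`, where the `E_k(x)` are the successive waiting times. -/
def ring {d : ℕ} (clock : Site d × ℕ → ℝ) (x : Site d) (n : ℕ) : ℝ :=
  ∑ k ∈ Finset.range n, clock (x, k)

/-- The time until the clock of `x` would ring next. The local time of `x` runs at a speed equal to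
the number of active particles at `x`; it does not run at a stable site. -/
def waiting {d : ℕ} (clock : Site d × ℕ → ℝ) (s : State d) (x : Site d) : ℝ≥0∞ :=
  if (s.config x).numActive = 0 then ⊤
  else ENNReal.ofReal
    ((ring clock x (s.odometer x + 1) - s.localTime x) / ((s.config x).numActive : ℝ))

/-- The clock of `x` is the next one to ring. -/
def RingsNext {d : ℕ} (clock : Site d × ℕ → ℝ) (s : State d) (x : Site d) : Prop :=
  waiting clock s x ≠ ⊤ ∧ ∀ y, waiting clock s x ≤ waiting clock s y

open Classical in
/-- Run all local times until the next clock rings, say that of `x`, then topple `x` with the next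
unused instruction of the stack of `x`. If no clock will ever ring (every site is stable), nothing
happens any more: the next event takes place at time `∞`. -/
def step {d : ℕ} (instr : Site d × ℕ → Instr d) (clock : Site d × ℕ → ℝ) (s : State d) :
    State d :=
  if h : ∃ x, RingsNext clock s x then
    let x := h.choose
    let δ := waiting clock s x
    { config := topple x (instr (x, s.odometer x)) s.config
      odometer := Function.update s.odometer x (s.odometer x + 1)
      localTime := fun y => s.localTime y + ((s.config y).numActive : ℝ) * δ.toReal
      time := s.time + δ }
  else { s with time := ⊤ }

/-- The state just after the `n`-th toppling, starting from the configuration `ξ`. -/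
def stateAfter {d : ℕ} (instr : Site d × ℕ → Instr d) (clock : Site d × ℕ → ℝ) (ξ : Config d)
    (n : ℕ) : State d :=
  (step instr clock)^[n] ⟨ξ, fun _ => 0, fun _ => 0, 0⟩

/-- The configuration at time `t` of the evolution started from `ξ` (with finitely many particles):
the one produced by the last toppling that takes place at or before time `t`. -/
def finiteEvolution {d : ℕ} (instr : Site d × ℕ → Instr d) (clock : Site d × ℕ → ℝ)
    (ξ : Config d) (t : ℝ≥0) : Config d :=
  (stateAfter instr clock ξ (sSup {n : ℕ | (stateAfter instr clock ξ n).time ≤ (t : ℝ≥0∞)})).config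

/-! ### The infinite system -/

/-- The restriction of `η` to the box `{-n, …, n}^d`. -/
def truncate {d : ℕ} (n : ℕ) (η : Config d) : Config d :=
  fun x => if ∀ i, |x i| ≤ (n : ℤ) then η x else Occ.active 0

open Classical in
/-- The limit, for the discrete topology, of a family of site states along a filter, that is, its
eventually constant value (vacant if there is none). -/
def eventualValue {α : Type*} (l : Filter α) (u : α → Occ) : Occ :=
  if h : ∃ v, ∀ᶠ a in l, u a = v then h.choose else Occ.active 0

/-- The sources of randomness: the initial configuration, the stacks of instructions and the waiting
times of the clocks. -/
abbrev Sample (d : ℕ) : Type :=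
  Config d × (Site d × ℕ → Instr d) × (Site d × ℕ → ℝ)

/-- The Activated Random Walk process `η_t(x)`: the right-continuous version of the limit, as the
box increases to `ℤ^d`, of the evolutions started from the restriction of the initial configuration
to the box. -/
def process {d : ℕ} (ω : Sample d) (t : ℝ≥0) (x : Site d) : Occ :=
  eventualValue (𝓝[>] t) fun s =>
    eventualValue atTop fun n : ℕ => finiteEvolution ω.2.1 ω.2.2 (truncate n ω.1) s x

/-- Each site is eventually always stable. -/
def Fixates {d : ℕ} (ω : Sample d) : Prop :=
  ∀ x : Site d, ∃ T : ℝ≥0, ∀ t ≥ T, (process ω t x).Stable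

/-- Each site has at least one active particle at arbitrarily large times. -/
def StaysActive {d : ℕ} (ω : Sample d) : Prop :=
  ∀ x : Site d, ∀ T : ℝ≥0, ∃ t ≥ T, 1 ≤ (process ω t x).numActive

/-! ### Laws -/

/-- The law of one instruction: try to sleep with probability `lam / (1 + lam)`, jump by `z` with
probability `p z / (1 + lam)`. -/
def instrLaw {d : ℕ} (p : PMF (Site d)) (lam : ℝ≥0) : Measure (Instr d) :=
  (lam / (1 + lam)) • Measure.dirac Instr.sleep +
    (1 / (1 + lam)) • p.toMeasure.map Instr.jump

instance {d : ℕ} (p : PMF (Site d)) (lam : ℝ≥0) : IsProbabilityMeasure (instrLaw p lam) := by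
  have hm : Measurable (Instr.jump : Site d → Instr d) := measurable_of_countable _
  have : IsProbabilityMeasure (p.toMeasure.map (Instr.jump : Site d → Instr d)) :=
    Measure.isProbabilityMeasure_map hm.aemeasurable
  have hne : (1 + lam : ℝ≥0) ≠ 0 := by positivity
  constructor
  simp only [instrLaw, Measure.add_apply, Measure.smul_apply, measure_univ]
  rw [ENNReal.smul_def, ENNReal.smul_def, smul_eq_mul, smul_eq_mul, mul_one, mul_one,
    ← ENNReal.coe_add, ← add_div, add_comm lam 1, div_self hne, ENNReal.coe_one]

/-- The law of one waiting time: exponential with rate `1 + lam`. -/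
def clockLaw (lam : ℝ≥0) : Measure ℝ := expMeasure (1 + (lam : ℝ))

instance (lam : ℝ≥0) : IsProbabilityMeasure (clockLaw lam) :=
  isProbabilityMeasure_expMeasure (by positivity)

/-- The joint law, under which the initial configuration has law `ν`, all instructions and all
waiting times are identically distributed, and everything is independent. -/
def sampleLaw {d : ℕ} (p : PMF (Site d)) (lam : ℝ≥0) (ν : Measure (Config d)) :
    Measure (Sample d) :=
  ν.prod ((Measure.infinitePi fun _ : Site d × ℕ => instrLaw p lam).prod
    (Measure.infinitePi fun _ : Site d × ℕ => clockLaw lam))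

/-- Translation of a configuration. -/
def shift {d : ℕ} (z : Site d) (η : Config d) : Config d := fun x => η (x + z)

/-- `ν` is invariant under all translations, and trivial on the events that are. -/
def IsTranslationErgodic {d : ℕ} (ν : Measure (Config d)) : Prop :=
  (∀ z, MeasurePreserving (shift z) ν ν) ∧
    ∀ A : Set (Config d), MeasurableSet A → (∀ z, shift z ⁻¹' A = A) → ν A = 0 ∨ ν A = 1

/-- The average density of particles `∫ |η(0)| ν(dη)`. -/
def density {d : ℕ} (ν : Measure (Config d)) : ℝ≥0∞ := ∫⁻ η, ((η 0).card : ℝ≥0∞) ∂ν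

/-- The initial laws by which the critical density is defined: translation-ergodic probability
measures with finite density under which there are almost surely no sleeping particles. -/
structure IsActiveInitialLaw {d : ℕ} (ν : Measure (Config d)) : Prop where
  isProbabilityMeasure : IsProbabilityMeasure ν
  ergodic : IsTranslationErgodic ν
  density_ne_top : density ν ≠ ⊤
  no_sleeping : ∀ᵐ η ∂ν, ∀ x, η x ≠ Occ.sleeping

/-- `ζc` is the critical density for the jump distribution `p` and the sleep rate `lam`: for every
active initial law of density `ζ`, the probability that the system stays active is `0` if
`ζ < ζc` and `1` if `ζ > ζc`. -/
def IsCriticalDensity {d : ℕ} (p : PMF (Site d)) (lam : ℝ≥0) (ζc : ℝ) : Prop :=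
  ∀ ν : Measure (Config d), IsActiveInitialLaw ν →
    ((density ν).toReal < ζc → ∀ᵐ ω ∂sampleLaw p lam ν, ¬ StaysActive ω) ∧
    (ζc < (density ν).toReal → ∀ᵐ ω ∂sampleLaw p lam ν, StaysActive ω)

end ARW

end

/-! Stabilize a finite set V of sites: topple active sites of V until none is left. The result and
the number of topplings at each site do not depend on the order (`exec_eq_of_isStable`), and no
legal sequence topples more than a stabilizing one (`Legal.subperm`). This freedom is used to single
out a site x: at first x is toppled only while it holds at least two active particles. If x is
visited at all, this ends with exactly one active particle at x after reading, say, j instructions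
there. The next one is independent of all this and is `sleep` with probability λ/(1+λ); in that case
V is now stable and x is occupied. So λ/(1+λ) times the probability that x is toppled is at most the
probability that x ends up occupied (`mul_measure_reaches_le`). There are at most as many occupied
sites as initial particles; summing over V (`sum_measure_reaches_le`) and averaging over large boxes
gives λ/(1+λ) · P(0 is ever toppled) ≤ ζ (`mul_measure_reaches_one_le`).

If ζ < λ/(1+λ), it is thus not almost sure that all sites can be toppled arbitrarily often, and by
the zero-one law for an ergodic field times independent stacks (`prod_infinitePi_zero_one`) this
event is null. Unbounded toppling spreads along possible jumps, and by stationarity also against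
them. As these jumps generate the lattice, almost surely no site is toppled without bound
(`ae_exists_not_reaches`).

In continuous time the finite systems carry out legal sequences, so their topplings at x are bounded
uniformly in the box. A site that is active is toppled again within bounded time, hence it cannot be
active at arbitrarily late times (`fixates_of_not_reaches`). A critical density below λ/(1+λ) would
then be contradicted by a Bernoulli initial law of intermediate density. -/

noncomputable section

namespace ARW

variable {d : ℕ}

/-! ### Toppling sequences -/

/-- Stacks of instructions at the sites. -/
abbrev Stack (d : ℕ) : Type := Site d × ℕ → Instr d

/-- A configuration together with the number of instructions already used at each site. -/
abbrev Stage (d : ℕ) : Type := Config d × (Site d → ℕ)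

namespace Occ

theorem numActive_le_add (a : Occ) : a.numActive ≤ a.add.numActive := by
  cases a <;> simp [add, numActive]

theorem card_add (a : Occ) : a.add.card = a.card + 1 := by
  cases a <;> simp [add, card]

theorem card_remove (a : Occ) : a.card ≤ a.remove.card + 1 := by
  cases a <;> simp [remove, card]; omega

theorem card_remove_of_active {a : Occ} (h : 1 ≤ a.numActive) : a.remove.card + 1 = a.card := by
  cases a <;> simp_all [remove, card, numActive]

theorem card_trySleep (a : Occ) : a.trySleep.card = a.card := by
  cases a <;> simp [trySleep, card]; split_ifs <;> simp_all

theorem stable_of_numActive_eq_zero {a : Occ} (h : a.numActive = 0) : a.Stable := by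
  cases a <;> simp_all [Stable, numActive]

theorem Stable.numActive_eq_zero {a : Occ} (h : a.Stable) : a.numActive = 0 := by
  rcases h with rfl | rfl <;> rfl

theorem card_le_one_of_numActive_eq_zero {a : Occ} (h : a.numActive = 0) : a.card ≤ 1 := by
  cases a <;> simp_all [card, numActive]

/-- For a lone particle this is the rule 𝔰 + 1 = 2: falling asleep just before an arrival has no
effect. It fails at a vacant site, where the arriving particle itself could fall asleep. -/
theorem trySleep_add {a : Occ} (h : 1 ≤ a.numActive) : a.trySleep.add = a.add.trySleep := by
  cases a with
  | sleeping => simp [numActive] at h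
  | active n =>
    simp only [numActive] at h
    rcases Nat.eq_or_lt_of_le h with rfl | h
    · simp [trySleep, add]
    · simp only [trySleep, add]
      rw [if_neg (by omega), if_neg (by omega)]

theorem remove_add {a : Occ} (h : 1 ≤ a.numActive) : a.remove.add = a.add.remove := by
  cases a with
  | sleeping => simp [numActive] at h
  | active n =>
    simp only [numActive] at h
    simp only [remove, add]
    congr 1; omega

/-- The order `0 < 𝔰 < 1 < 2 < ⋯`. -/
def Below (a b : Occ) : Prop := a.numActive ≤ b.numActive ∧ a.card ≤ b.card

theorem Below.add {a b : Occ} (h : Below a b) : Below a.add b.add := by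
  obtain ⟨h₁, h₂⟩ := h
  cases a <;> cases b <;> simp_all [Below, Occ.add, numActive, card]

theorem Below.remove {a b : Occ} (h : Below a b) (ha : 1 ≤ a.numActive) :
    Below a.remove b.remove := by
  obtain ⟨h₁, h₂⟩ := h
  cases a <;> cases b <;> simp_all [Below, Occ.remove, numActive, card]; omega

theorem Below.trySleep {a b : Occ} (h : Below a b) : Below a.trySleep b.trySleep := by
  obtain ⟨h₁, h₂⟩ := h
  cases a <;> cases b <;> simp only [Below, Occ.trySleep] <;> (try split_ifs) <;>
    simp_all [numActive, card]; omega

end Occ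

/-- The abelian property. Toppling one site affects another only by adding a particle there, and
this commutes with the instruction at an active site. -/
theorem topple_comm {x y : Site d} (hxy : x ≠ y) (i j : Instr d) {η : Config d}
    (hx : 1 ≤ (η x).numActive) (hy : 1 ≤ (η y).numActive) :
    topple x i (topple y j η) = topple y j (topple x i η) := by
  have h₁ := Occ.trySleep_add hx
  have h₂ := Occ.trySleep_add hy
  have h₃ := Occ.remove_add hx
  have h₄ := Occ.remove_add hy
  funext w
  clear hx hy
  cases i <;> cases j <;> simp only [topple, Function.update_apply] <;> grind

theorem numActive_le_topple {x y : Site d} (hxy : y ≠ x) (i : Instr d) (η : Config d) :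
    (η y).numActive ≤ (topple x i η y).numActive := by
  cases i with
  | sleep => simp [topple, hxy]
  | jump z =>
    simp only [topple, Function.update_apply]
    split_ifs <;> simp_all [Occ.numActive_le_add]

theorem card_le_topple {x y : Site d} (hxy : y ≠ x) (i : Instr d) (η : Config d) :
    (η y).card ≤ (topple x i η y).card := by
  cases i with
  | sleep => simp [topple, hxy]
  | jump z =>
    simp only [topple, Function.update_apply]
    split_ifs <;> simp_all [Occ.card_add]

theorem card_topple_self (x : Site d) (i : Instr d) (η : Config d) :
    (η x).card ≤ (topple x i η x).card + 1 := by
  have := Occ.card_remove (η x)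
  cases i with
  | sleep => simp [topple, Occ.card_trySleep]
  | jump z =>
    simp only [topple, Function.update_apply]
    split_ifs <;> grind [Occ.card_add]

theorem card_topple_target {x z : Site d} (hz : z ≠ 0) (η : Config d) :
    (topple x (Instr.jump z) η (x + z)).card = (η (x + z)).card + 1 := by
  simp [topple, Occ.card_add, hz]

theorem below_topple {x : Site d} (i : Instr d) {η η' : Config d} (h : ∀ y, (η y).Below (η' y))
    (hx : 1 ≤ (η x).numActive) (y : Site d) : (topple x i η y).Below (topple x i η' y) := by
  have h₁ := (h x).trySleep
  have h₂ := (h x).remove hx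
  cases i <;> simp only [topple, Function.update_apply] <;> split_ifs <;>
    first
    | exact h₁ | exact h₂ | exact h _ | exact h₂.add | exact (h _).add

theorem sum_card_topple_le {x : Site d} (i : Instr d) {η : Config d} (hx : 1 ≤ (η x).numActive)
    {W : Finset (Site d)} (hW : x ∈ W) :
    ∑ y ∈ W, (topple x i η y).card ≤ ∑ y ∈ W, (η y).card := by
  classical
  cases i with
  | sleep =>
    refine Finset.sum_le_sum fun y _ => ?_
    simp only [topple, Function.update_apply]
    split_ifs with h
    · rw [h, Occ.card_trySleep]
    · rfl
  | jump z =>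
    -- The departure is put on the left and the arrival on the right, which avoids truncated
    -- subtraction and covers `z = 0` too.
    have h₁ : ∀ y, (topple x (Instr.jump z) η y).card + (if y = x then 1 else 0) =
        (η y).card + (if y = x + z then 1 else 0) := by
      intro y
      have := Occ.card_remove_of_active hx
      simp only [topple, Function.update_apply]
      split_ifs <;> simp_all [Occ.card_add]
    have h₂ := Finset.sum_congr (rfl : W = W) fun y _ => h₁ y
    rw [Finset.sum_add_distrib, Finset.sum_add_distrib, Finset.sum_ite_eq', if_pos hW,
      Finset.sum_ite_eq'] at h₂
    split_ifs at h₂ <;> omega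

/-- Use the next instruction of the stack of `x`. -/
def move (ι : Stack d) (x : Site d) (s : Stage d) : Stage d :=
  (topple x (ι (x, s.2 x)) s.1, Function.update s.2 x (s.2 x + 1))

/-- Topple successively the sites of a list. -/
def exec (ι : Stack d) : List (Site d) → Stage d → Stage d
  | [], s => s
  | x :: α, s => exec ι α (move ι x s)

/-- A site can be toppled when it holds at least `θ x` active particles. -/
def Legal (θ : Site d → ℕ∞) (ι : Stack d) : List (Site d) → Stage d → Prop
  | [], _ => True
  | x :: α, s => θ x ≤ (s.1 x).numActive ∧ Legal θ ι α (move ι x s)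

/-- No site can be toppled. -/
def IsStable (θ : Site d → ℕ∞) (s : Stage d) : Prop := ∀ x, ¬ θ x ≤ (s.1 x).numActive

variable {θ θ' : Site d → ℕ∞} {ι ι' : Stack d} {α β : List (Site d)} {s : Stage d}
  {x y z : Site d}

theorem exec_append (α β : List (Site d)) (s : Stage d) :
    exec ι (α ++ β) s = exec ι β (exec ι α s) := by
  induction α generalizing s with
  | nil => rfl
  | cons x α ih => exact ih _

theorem legal_append :
    Legal θ ι (α ++ β) s ↔ Legal θ ι α s ∧ Legal θ ι β (exec ι α s) := by
  induction α generalizing s with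
  | nil => simp [Legal, exec]
  | cons x α ih => simp [Legal, exec, ih, and_assoc]

theorem Legal.mono (h : ∀ x, θ' x ≤ θ x) (hα : Legal θ ι α s) : Legal θ' ι α s := by
  induction α generalizing s with
  | nil => trivial
  | cons x α ih => exact ⟨(h x).trans hα.1, ih hα.2⟩

theorem exec_snd (α : List (Site d)) (s : Stage d) (y : Site d) :
    (exec ι α s).2 y = s.2 y + α.count y := by
  induction α generalizing s with
  | nil => simp [exec]
  | cons x α ih =>
    simp only [exec, ih, List.count_cons, move, Function.update_apply]
    by_cases h : y = x
    · subst h; simp; omega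
    · simp [h, Ne.symm h]

theorem one_le_of_le (hθ : ∀ x, 1 ≤ θ x) {n : ℕ} (h : θ x ≤ n) : 1 ≤ n := by
  exact_mod_cast (hθ x).trans h

theorem move_comm (hxy : x ≠ y) (hx : 1 ≤ (s.1 x).numActive) (hy : 1 ≤ (s.1 y).numActive) :
    move ι x (move ι y s) = move ι y (move ι x s) := by
  simp only [move, Function.update_of_ne hxy, Function.update_of_ne hxy.symm]
  rw [topple_comm hxy _ _ hx hy, Function.update_comm hxy]

/-! ### Exchange property and least action. -/

theorem le_numActive_move (hxy : y ≠ x) (h : θ y ≤ (s.1 y).numActive) :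
    θ y ≤ ((move ι x s).1 y).numActive :=
  h.trans (by exact_mod_cast numActive_le_topple hxy _ _)

/-- Exchange property: a legal toppling that a stabilizing sequence postpones can be done first. -/
theorem legal_cons_erase (hθ : ∀ x, 1 ≤ θ x) (hβ : Legal θ ι β s)
    (hs : IsStable θ (exec ι β s)) (hx : θ x ≤ (s.1 x).numActive) :
    x ∈ β ∧ Legal θ ι (x :: β.erase x) s ∧ exec ι (x :: β.erase x) s = exec ι β s := by
  induction β generalizing s with
  | nil => exact absurd hx (hs x)
  | cons y β ih =>
    by_cases hxy : y = x
    · subst hxy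
      simp only [List.mem_cons, true_or, List.erase_cons_head, true_and]
      exact ⟨hβ, trivial⟩
    -- Toppling `y` leaves `x` legal, so by induction `x` can be brought to the place right after
    -- `y`; the two then commute.
    · obtain ⟨h₁, h₂, h₃⟩ := ih hβ.2 hs (le_numActive_move (Ne.symm hxy) hx)
      have hc := move_comm (ι := ι) (s := s) hxy (one_le_of_le hθ hβ.1) (one_le_of_le hθ hx)
      rw [List.erase_cons_tail (by simpa using hxy)]
      refine ⟨List.mem_cons_of_mem _ h₁, ⟨hx, le_numActive_move hxy hβ.1, ?_⟩, ?_⟩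
      · rw [hc]; exact h₂.2
      · rw [← show exec ι (y :: β) s = exec ι β (move ι y s) from rfl] at h₃
        rw [← h₃]
        simp only [exec]
        rw [hc]

/-- Least action principle. -/
theorem Legal.subperm (hθ : ∀ x, 1 ≤ θ x) (hα : Legal θ ι α s) (hβ : Legal θ ι β s)
    (hs : IsStable θ (exec ι β s)) : α.Subperm β := by
  induction α generalizing s β with
  | nil => exact List.nil_subperm
  | cons x α ih =>
    obtain ⟨h₁, h₂, h₃⟩ := legal_cons_erase hθ hβ hs hα.1
    have := ih hα.2 h₂.2 (by rw [← h₃] at hs; exact hs)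
    exact ((List.subperm_cons x).2 this).trans (List.perm_cons_erase h₁).symm.subperm

/-- Two stabilizing sequences lead to the same stage. -/
theorem exec_eq_of_isStable (hθ : ∀ x, 1 ≤ θ x) (hα : Legal θ ι α s) (hβ : Legal θ ι β s)
    (hsα : IsStable θ (exec ι α s)) (hsβ : IsStable θ (exec ι β s)) :
    exec ι α s = exec ι β s := by
  induction α generalizing s β with
  | nil =>
    cases β with
    | nil => rfl
    | cons y β => exact absurd hβ.1 (hsα y)
  | cons x α ih =>
    obtain ⟨h₁, h₂, h₃⟩ := legal_cons_erase hθ hβ hsβ hα.1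
    rw [← h₃] at hsβ ⊢
    exact ih hα.2 h₂.2 hsα hsβ

/-- A legal sequence of maximal length is stabilizing. -/
theorem exists_stabilizing {N : ℕ} (h : ∀ α, Legal θ ι α s → α.length ≤ N) :
    ∃ β, Legal θ ι β s ∧ IsStable θ (exec ι β s) := by
  classical
  let P : ℕ → Prop := fun n => ∃ α, Legal θ ι α s ∧ α.length = n
  have hP : P (Nat.findGreatest P N) :=
    Nat.findGreatest_spec (P := P) (Nat.zero_le N) ⟨[], trivial, rfl⟩
  obtain ⟨β, hβ, hlen⟩ := hP
  refine ⟨β, hβ, fun x hx => ?_⟩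
  have hL : Legal θ ι (β ++ [x]) s := legal_append.2 ⟨hβ, hx, trivial⟩
  have : (β ++ [x]).length ≤ Nat.findGreatest P N :=
    Nat.le_findGreatest (h _ hL) ⟨_, hL, rfl⟩
  simp [hlen] at this

/-- A sequence of topplings reads only the listed instructions. This is the source of the
independence of the first unread one. -/
theorem Legal.congr (h : ∀ y k, s.2 y ≤ k → k < s.2 y + α.count y → ι (y, k) = ι' (y, k)) :
    (Legal θ ι α s ↔ Legal θ ι' α s) ∧ exec ι α s = exec ι' α s := by
  induction α generalizing s with
  | nil => exact ⟨Iff.rfl, rfl⟩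
  | cons x α ih =>
    have hm : move ι x s = move ι' x s := by
      rw [move, move, h x (s.2 x) le_rfl (by simp)]
    have := ih (s := move ι x s) fun y k h₁ h₂ => by
      simp only [move, Function.update_apply] at h₁ h₂
      refine h y k ?_ ?_
      · split_ifs at h₁ with hh
        · subst hh; omega
        · exact h₁
      · rw [List.count_cons]
        split_ifs at h₂ with hh
        · subst hh; simp; omega
        · omega
    simp only [Legal, exec]
    rw [this.1, this.2, hm]
    exact ⟨Iff.rfl, rfl⟩

theorem Legal.sum_card_le (hθ : ∀ x, 1 ≤ θ x) {W : Finset (Site d)} (hα : Legal θ ι α s)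
    (hW : ∀ x ∈ α, x ∈ W) : ∑ y ∈ W, ((exec ι α s).1 y).card ≤ ∑ y ∈ W, (s.1 y).card := by
  induction α generalizing s with
  | nil => exact le_rfl
  | cons x α ih =>
    exact (ih hα.2 fun y hy => hW y (List.mem_cons_of_mem _ hy)).trans
      (sum_card_topple_le _ (one_le_of_le hθ hα.1) (hW x List.mem_cons_self))

-- Induction step for `jumps_le`: a jump by `z` from `x` adds a particle at `x + z`, a toppling of
-- `x + z` removes at most one, and all other topplings can only add there.
open Classical in
theorem jumps_le_move (hz : z ≠ 0) (y : Site d)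
    (h : Nat.count (fun k => ι (x, k) = Instr.jump z) (s.2 x) ≤
      (s.1 (x + z)).card + s.2 (x + z)) :
    Nat.count (fun k => ι (x, k) = Instr.jump z) ((move ι y s).2 x) ≤
      ((move ι y s).1 (x + z)).card + (move ι y s).2 (x + z) := by
  have hxz : x + z ≠ x := by simpa using hz
  by_cases h₁ : y = x
  · subst h₁
    simp only [move, Function.update_self, Function.update_of_ne hxz, Nat.count_succ]
    split_ifs with hi
    · rw [hi, card_topple_target hz]; omega
    · have := card_le_topple hxz (ι (y, s.2 y)) s.1
      omega
  · by_cases h₂ : y = x + z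
    · subst h₂
      simp only [move, Function.update_self, Function.update_of_ne hxz.symm]
      have := card_topple_self (x + z) (ι (x + z, s.2 (x + z))) s.1
      omega
    · simp only [move, Function.update_of_ne (Ne.symm h₁), Function.update_of_ne (Ne.symm h₂)]
      have := card_le_topple (Ne.symm h₂) (ι (y, s.2 y)) s.1
      omega

open Classical in
/-- The particles that have jumped by `z` from `x` are at `x + z`, or have left that site. -/
theorem jumps_le (hz : z ≠ 0) (η : Config d) (α : List (Site d)) :
    Nat.count (fun k => ι (x, k) = Instr.jump z) (α.count x) ≤
      ((exec ι α (η, 0)).1 (x + z)).card + α.count (x + z) := by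
  suffices H : ∀ (α : List (Site d)) (s : Stage d),
      Nat.count (fun k => ι (x, k) = Instr.jump z) (s.2 x) ≤
        (s.1 (x + z)).card + s.2 (x + z) →
      Nat.count (fun k => ι (x, k) = Instr.jump z) ((exec ι α s).2 x) ≤
        ((exec ι α s).1 (x + z)).card + (exec ι α s).2 (x + z) by
    have := H α (η, 0) (by simp)
    simpa [exec_snd] using this
  intro α
  induction α with
  | nil => exact fun s h => h
  | cons y α ih => exact fun s h => ih _ (jumps_le_move hz y h)

/-- Toppling preserves the order of configurations, so additional particles never obstruct a
sequence. This lets the infinite system dominate its truncations. -/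
theorem Legal.of_below (hθ : ∀ x, 1 ≤ θ x) {η η' : Config d} {m : Site d → ℕ}
    (h : ∀ y, (η y).Below (η' y)) (hα : Legal θ ι α (η, m)) : Legal θ ι α (η', m) := by
  induction α generalizing η η' m with
  | nil => trivial
  | cons x α ih =>
    exact ⟨hα.1.trans (by exact_mod_cast (h x).1),
      ih (below_topple _ h (one_le_of_le hθ hα.1)) hα.2⟩

/-! ### Translations -/

theorem topple_shift (i : Instr d) (η : Config d) :
    topple x i (shift z η) = shift z (topple (x + z) i η) := by
  funext y
  cases i with
  | sleep => simp [topple, shift, Function.update_apply]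
  | jump w =>
    have h₁ : (x + z + w = x + z) ↔ x + w = x := by
      constructor <;> intro h <;> simpa using h
    have h₂ : (y + z = x + z + w) ↔ y = x + w := by
      rw [add_right_comm]; simp
    simp only [topple, shift, Function.update_apply, add_left_inj, h₁, h₂, add_right_comm x w z]

/-- Translation of the stacks. -/
def shiftStack (z : Site d) (ι : Stack d) : Stack d := fun k => ι (k.1 + z, k.2)

theorem legal_shift (η : Config d) (m : Site d → ℕ) (hθ : ∀ x, θ' x = θ (x + z)) :
    Legal θ' (shiftStack z ι) α (shift z η, fun y => m (y + z)) ↔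
      Legal θ ι (α.map (· + z)) (η, m) := by
  induction α generalizing η m with
  | nil => simp [Legal]
  | cons x α ih =>
    simp only [Legal, List.map_cons, shift, hθ]
    refine and_congr Iff.rfl ?_
    have : move (shiftStack z ι) x (shift z η, fun y => m (y + z)) =
        (shift z (move ι (x + z) (η, m)).1, fun y => (move ι (x + z) (η, m)).2 (y + z)) := by
      simp only [move, shiftStack, topple_shift, Prod.mk.injEq, true_and]
      funext y
      simp [Function.update_apply]
    change Legal θ' (shiftStack z ι) α (move (shiftStack z ι) x
      (shift z η, fun y => m (y + z))) ↔ _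
    rw [this]
    exact ih _ _

/-! ### Number of topplings -/

/-- Some legal sequence of topplings, started from `η`, topples `x` at least `n` times. -/
def Reaches (θ : Site d → ℕ∞) (ι : Stack d) (η : Config d) (x : Site d) (n : ℕ) : Prop :=
  ∃ α, Legal θ ι α (η, 0) ∧ n ≤ α.count x

open Classical in
/-- The thresholds for which the sites of `V` can be toppled as soon as they are active, and the
other sites never. -/
def inside (V : Finset (Site d)) : Site d → ℕ∞ := fun x => if x ∈ V then 1 else ⊤

theorem one_le_inside (V : Finset (Site d)) (x : Site d) : 1 ≤ inside V x := by
  unfold inside; split_ifs <;> simp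

theorem Reaches.mono {η : Config d} {n : ℕ} (h : ∀ x, θ' x ≤ θ x) (hr : Reaches θ ι η x n) :
    Reaches θ' ι η x n :=
  let ⟨α, h₁, h₂⟩ := hr
  ⟨α, h₁.mono h, h₂⟩

theorem Legal.mem_of_inside {V : Finset (Site d)} (h : Legal (inside V) ι α s) :
    ∀ x ∈ α, x ∈ V := by
  induction α generalizing s with
  | nil => simp
  | cons y α ih =>
    intro x hx
    rcases List.mem_cons.1 hx with rfl | hx
    · by_contra hV
      have := h.1
      simp [inside, hV] at this
    · exact ih h.2 x hx

theorem Legal.inside_of_forall_mem {V : Finset (Site d)} (h : Legal 1 ι α s)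
    (hα : ∀ x ∈ α, x ∈ V) : Legal (inside V) ι α s := by
  induction α generalizing s with
  | nil => trivial
  | cons y α ih =>
    refine ⟨?_, ih h.2 fun x hx => hα x (List.mem_cons_of_mem _ hx)⟩
    rw [inside, if_pos (hα y List.mem_cons_self)]
    exact h.1

theorem IsStable.card_le_one {V : Finset (Site d)} (h : IsStable (inside V) s) (hx : x ∈ V) :
    (s.1 x).card ≤ 1 := by
  have := h x
  rw [inside, if_pos hx] at this
  refine Occ.card_le_one_of_numActive_eq_zero ?_
  by_contra hn
  exact this (by exact_mod_cast Nat.one_le_iff_ne_zero.2 hn)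

/-- Every jump that has positive probability occurs infinitely often in each stack. -/
def Rich (P : Set (Site d)) (ι : Stack d) : Prop :=
  ∀ x, ∀ z ∈ P, ∃ᶠ k in atTop, ι (x, k) = Instr.jump z

open Classical in
theorem Rich.exists_lt_count {P : Set (Site d)} (h : Rich P ι) (x : Site d) (hz : z ∈ P) (C : ℕ) :
    ∃ N, ∀ n ≥ N, C < Nat.count (fun k => ι (x, k) = Instr.jump z) n := by
  have hinf : (Set.ofPred fun k => ι (x, k) = Instr.jump z).Infinite :=
    Nat.frequently_atTop_iff_infinite.1 (h x z hz)
  obtain ⟨N, hN⟩ : ∃ N, Nat.count (fun k => ι (x, k) = Instr.jump z) N = C + 1 :=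
    ⟨_, Nat.count_nth_of_infinite hinf _⟩
  exact ⟨N, fun n hn => by have := Nat.count_monotone (fun k => ι (x, k) = Instr.jump z) hn; omega⟩

/-- In a finite set of sites the number of topplings is bounded, as particles leave it. -/
theorem Rich.bounded_count {P : Set (Site d)} (h : Rich P ι) (hz : z ∈ P) (hz₀ : z ≠ 0)
    (V : Finset (Site d)) (η : Config d) (x : Site d) :
    ∃ N, ∀ α, Legal (inside V) ι α (η, 0) → α.count x ≤ N := by
  classical
  -- Repeated steps `z` from `x` leave `V`; the induction is on the number of steps needed, starting
  -- from sites outside `V`, which are never toppled.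
  have hout : ∃ k : ℕ, x + (k : ℤ) • z ∉ V := by
    by_contra! hV
    refine Set.infinite_of_injective_forall_mem (f := fun k : ℕ => x + (k : ℤ) • z) ?_ hV
      V.finite_toSet
    intro a b hab
    obtain ⟨i, hi⟩ := Function.ne_iff.1 hz₀
    have := congrFun hab i
    simpa [show z i ≠ 0 from hi] using this
  obtain ⟨k, hk⟩ := hout
  induction k generalizing x with
  | zero =>
    refine ⟨0, fun α hα => ?_⟩
    rw [Nat.le_zero, List.count_eq_zero]
    exact fun hx => hk (by simpa using hα.mem_of_inside x hx)
  | succ k ih =>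
    obtain ⟨N, hN⟩ := ih (x + z) (by
      rw [add_assoc, show z + (k : ℤ) • z = ((k + 1 : ℕ) : ℤ) • z by push_cast; module]; exact hk)
    -- More jumps to `x + z` than this are impossible: at most `N` particles leave that site, and
    -- the rest cannot outnumber all the particles. The site is inserted because it may lie outside
    -- `V`.
    obtain ⟨N', hN'⟩ := h.exists_lt_count x hz (∑ y ∈ insert (x + z) V, (η y).card + N)
    refine ⟨N', fun α hα => ?_⟩
    by_contra! hlt
    have h₁ := hN' _ hlt.le
    have h₂ := jumps_le (ι := ι) (x := x) hz₀ η α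
    have h₃ := hN α hα
    have h₄ := hα.sum_card_le (one_le_inside V) (W := insert (x + z) V)
      fun y hy => Finset.mem_insert_of_mem (hα.mem_of_inside y hy)
    have h₅ : ((exec ι α (η, 0)).1 (x + z)).card ≤ _ := Finset.single_le_sum
      (f := fun y => ((exec ι α (η, 0)).1 y).card) (fun _ _ => Nat.zero_le _)
      (Finset.mem_insert_self (x + z) V)
    simp only at h₄
    omega

theorem length_le_of_count_le {D : Finset (Site d)} {B : Site d → ℕ} (hD : ∀ x ∈ α, x ∈ D)
    (hB : ∀ x, α.count x ≤ B x) : α.length ≤ ∑ x ∈ D, B x := by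
  have : α.length = ∑ x ∈ D, α.count x := by
    have := Multiset.sum_count_eq_card (s := D) (m := (α : Multiset (Site d)))
      (by simpa using hD)
    simpa using this.symm
  rw [this]
  exact Finset.sum_le_sum fun x _ => hB x

theorem Rich.bounded_length {P : Set (Site d)} (h : Rich P ι) (hz : z ∈ P) (hz₀ : z ≠ 0)
    (V : Finset (Site d)) (η : Config d) :
    ∃ N, ∀ α, Legal (inside V) ι α (η, 0) → α.length ≤ N := by
  choose B hB using h.bounded_count hz hz₀ V η
  exact ⟨∑ x ∈ V, B x, fun α hα => length_le_of_count_le hα.mem_of_inside fun x => hB x α hα⟩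

/-- If `x` can be toppled arbitrarily often, then so can each site to which particles jump
from `x`. -/
theorem Rich.reaches_add {P : Set (Site d)} (h : Rich P ι) (hz : z ∈ P) {η : Config d}
    (hx : ∀ n, Reaches 1 ι η x n) (n : ℕ) : Reaches 1 ι η (x + z) n := by
  classical
  rcases eq_or_ne z 0 with rfl | hz₀
  · simpa using hx n
  obtain ⟨N, hN⟩ := h.exists_lt_count x hz n
  obtain ⟨α, hα, hcount⟩ := hx N
  -- Stabilizing `V` topples `x` at least as often as `α` does, so more than `n` particles are sent
  -- to `x + z`. At most one of them may remain there, which the strict inequality pays for.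
  let V := insert (x + z) α.toFinset
  obtain ⟨L, hL⟩ := h.bounded_length hz hz₀ V η
  obtain ⟨β, hβ, hs⟩ := exists_stabilizing hL
  have hsub := (hα.inside_of_forall_mem (V := V) fun y hy => by simp [V, hy]).subperm
    (one_le_inside V) hβ hs
  have h₁ := hN _ (hcount.trans (hsub.count_le x))
  have h₂ := jumps_le (ι := ι) (x := x) hz₀ η β
  have h₃ := hs.card_le_one (x := x + z) (by simp [V])
  refine ⟨β, hβ.mono fun y => one_le_inside V y, ?_⟩
  omega

/-- A finite number of topplings takes place in a finite set of sites. -/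
theorem reaches_one_iff {η : Config d} {n : ℕ} {V : ℕ → Finset (Site d)} (hV : Monotone V)
    (hV' : ∀ y, ∃ r, y ∈ V r) : Reaches 1 ι η x n ↔ ∃ r, Reaches (inside (V r)) ι η x n := by
  constructor
  · rintro ⟨α, hα, hn⟩
    choose r hr using hV'
    refine ⟨α.toFinset.sup r, α, hα.inside_of_forall_mem fun y hy => ?_, hn⟩
    exact hV (Finset.le_sup (f := r) (List.mem_toFinset.2 hy)) (hr y)
  · rintro ⟨r, hr⟩
    exact hr.mono fun y => one_le_inside _ y

/-! ### Weak stabilization -/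

/-- Thresholds for which a single active particle is left alone at `x`. -/
def weakly (V : Finset (Site d)) (x : Site d) : Site d → ℕ∞ := Function.update (inside V) x 2

theorem inside_le_weakly {V : Finset (Site d)} (hx : x ∈ V) (y : Site d) :
    inside V y ≤ weakly V x y := by
  rw [weakly, Function.update_apply]
  split_ifs with h
  · rw [h, inside, if_pos hx]; norm_num
  · rfl

theorem one_le_weakly {V : Finset (Site d)} (hx : x ∈ V) (y : Site d) : 1 ≤ weakly V x y :=
  (one_le_inside V y).trans (inside_le_weakly hx y)

theorem one_le_numActive_topple_self (i : Instr d) {η : Config d} (h : 2 ≤ (η x).numActive) :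
    1 ≤ (topple x i η x).numActive := by
  generalize ha : η x = a at h
  cases a with
  | sleeping => simp [Occ.numActive] at h
  | active n =>
    simp only [Occ.numActive] at h
    cases i with
    | sleep =>
      simp only [topple, Function.update_self, ha, Occ.trySleep]
      rw [if_neg (by omega)]; simp only [Occ.numActive]; omega
    | jump z =>
      simp only [topple, Function.update_apply]
      split_ifs <;> grind [Occ.remove, Occ.add, Occ.numActive]

/-- With two active particles or more at `x`, an instruction there removes at most one, and no
attempt to sleep succeeds. -/
theorem Legal.one_le_numActive {V : Finset (Site d)} (hα : Legal (weakly V x) ι α s)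
    (h : 1 ≤ (s.1 x).numActive) : 1 ≤ ((exec ι α s).1 x).numActive := by
  induction α generalizing s with
  | nil => exact h
  | cons y α ih =>
    refine ih hα.2 ?_
    by_cases hy : y = x
    · subst hy
      have := hα.1
      rw [weakly, Function.update_self] at this
      exact one_le_numActive_topple_self _ (by exact_mod_cast this)
    · exact h.trans (numActive_le_topple (Ne.symm hy) _ _)

theorem Legal.weakly_of_notMem {V : Finset (Site d)} (hα : Legal (inside V) ι α s) (hx : x ∉ α) :
    Legal (weakly V x) ι α s := by
  induction α generalizing s with
  | nil => trivial
  | cons y α ih =>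
    rw [List.mem_cons, not_or] at hx
    refine ⟨?_, ih hα.2 hx.2⟩
    rw [weakly, Function.update_of_ne (Ne.symm hx.1)]
    exact hα.1

/-- Weak stabilization leaves a particle at `x`, and uses `j` instructions there. -/
def WeaklyOccupied (V : Finset (Site d)) (η : Config d) (x : Site d) (j : ℕ) (ι : Stack d) :
    Prop :=
  ∃ β, Legal (weakly V x) ι β (η, 0) ∧ IsStable (weakly V x) (exec ι β (η, 0)) ∧
    1 ≤ ((exec ι β (η, 0)).1 x).numActive ∧ β.count x = j

/-- Stabilization in `V` leaves a particle at `x`. -/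
def Occupied (V : Finset (Site d)) (η : Config d) (x : Site d) (ι : Stack d) : Prop :=
  ∃ β, Legal (inside V) ι β (η, 0) ∧ IsStable (inside V) (exec ι β (η, 0)) ∧
    1 ≤ ((exec ι β (η, 0)).1 x).card

/-- Cut the sequence just before its first toppling of `x`: up to there it is legal for the weak
thresholds, and `x` is active. Continuing to a weakly stable stage never removes the last active
particle from `x`. -/
theorem Rich.exists_weaklyOccupied {P : Set (Site d)} (h : Rich P ι) (hz : z ∈ P) (hz₀ : z ≠ 0)
    {V : Finset (Site d)} {η : Config d} (hx : x ∈ V) (hr : Reaches (inside V) ι η x 1) :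
    ∃ j, WeaklyOccupied V η x j ι := by
  obtain ⟨α, hα, hc⟩ := hr
  obtain ⟨α₁, α₂, rfl, hα₁⟩ := List.eq_append_cons_of_mem (List.one_le_count_iff.1 hc)
  obtain ⟨hL, hact, -⟩ := legal_append.1 hα
  rw [inside, if_pos hx] at hact
  obtain ⟨N, hN⟩ := h.bounded_length hz hz₀ V η
  have hw := hL.weakly_of_notMem hα₁
  obtain ⟨γ, hγ, hs⟩ := exists_stabilizing (θ := weakly V x) (ι := ι) (s := exec ι α₁ (η, 0))
    (N := N) fun γ hγ => by
      have := hN _ ((legal_append.2 ⟨hw, hγ⟩).mono (inside_le_weakly hx))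
      rw [List.length_append] at this
      omega
  refine ⟨_, α₁ ++ γ, legal_append.2 ⟨hw, hγ⟩, ?_, ?_, rfl⟩
  · rwa [exec_append]
  · rw [exec_append]
    exact hγ.one_le_numActive (by exact_mod_cast hact)

/-- By the abelian property; it makes the events for different `j` disjoint, so that their
probabilities add up. -/
theorem WeaklyOccupied.unique {V : Finset (Site d)} {η : Config d} (hx : x ∈ V) {i j : ℕ}
    (hi : WeaklyOccupied V η x i ι) (hj : WeaklyOccupied V η x j ι) : i = j := by
  obtain ⟨β, h₁, h₂, -, rfl⟩ := hi
  obtain ⟨γ, h₃, h₄, -, rfl⟩ := hj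
  have := congrFun (congrArg Prod.snd (exec_eq_of_isStable (one_le_weakly hx) h₁ h₃ h₂ h₄)) x
  simpa [exec_snd] using this

/-- Weak stability leaves exactly one active particle at `x`. Its next instruction, numbered `j`,
sends it to sleep and completes the stabilization. -/
theorem WeaklyOccupied.occupied {V : Finset (Site d)} {η : Config d} (hx : x ∈ V) {j : ℕ}
    (h : WeaklyOccupied V η x j ι) (hj : ι (x, j) = Instr.sleep) : Occupied V η x ι := by
  obtain ⟨β, h₁, h₂, h₃, h₄⟩ := h
  have hmove : exec ι (β ++ [x]) (η, 0) = move ι x (exec ι β (η, 0)) := by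
    rw [exec_append]; rfl
  have hinstr : ι (x, (exec ι β (η, 0)).2 x) = Instr.sleep := by
    rw [exec_snd, h₄]; simpa using hj
  have h₅ : ((exec ι β (η, 0)).1 x) = Occ.active 1 := by
    have := h₂ x
    rw [weakly, Function.update_self] at this
    generalize (exec ι β (η, 0)).1 x = a at this h₃
    cases a with
    | sleeping => simp [Occ.numActive] at h₃
    | active n =>
      simp only [Occ.numActive] at this h₃
      have : ¬ 2 ≤ n := fun hn => this (by exact_mod_cast hn)
      congr 1; omega
  refine ⟨β ++ [x], legal_append.2 ⟨h₁.mono (inside_le_weakly hx), ?_, trivial⟩, ?_, ?_⟩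
  · rw [inside, if_pos hx]; exact_mod_cast h₃
  · rw [hmove]
    intro y
    simp only [move, hinstr, topple]
    by_cases hy : y = x
    · subst hy
      simp [h₅, Occ.trySleep, Occ.numActive, inside, hx]
    · have := h₂ y
      rw [weakly, Function.update_of_ne hy] at this
      rwa [Function.update_of_ne hy]
  · rw [hmove]
    simp [move, hinstr, topple, h₅, Occ.trySleep, Occ.card]

/-- Only the instructions `0, …, j - 1` of `x` are read, so the one numbered `j` may be changed. -/
theorem WeaklyOccupied.congr {V : Finset (Site d)} {η : Config d} {j : ℕ}
    (h : ∀ k ≠ (x, j), ι k = ι' k) (hw : WeaklyOccupied V η x j ι) :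
    WeaklyOccupied V η x j ι' := by
  obtain ⟨β, h₁, h₂, h₃, h₄⟩ := hw
  have := fun θ => Legal.congr (θ := θ) (ι := ι) (ι' := ι') (α := β) (s := (η, 0))
    fun y k _ hk => h _ fun he => by
      simp only [Prod.mk.injEq] at he
      obtain ⟨rfl, rfl⟩ := he
      simp [h₄] at hk
  refine ⟨β, (this _).1.1 h₁, ?_, ?_, h₄⟩
  · rwa [← (this (weakly V x)).2]
  · rwa [← (this (weakly V x)).2]

-- All stabilizing sequences end in the same configuration, so one of them accounts for every
-- occupied site, and topplings in `V` do not create particles.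
open Classical in
theorem sum_occupied_le (V : Finset (Site d)) (η : Config d) (ι : Stack d) :
    ∑ x ∈ V, (if Occupied V η x ι then 1 else 0) ≤ ∑ x ∈ V, (η x).card := by
  by_cases h : ∃ x, Occupied V η x ι
  · obtain ⟨-, β, h₁, h₂, -⟩ := h
    refine le_trans (Finset.sum_le_sum fun x _ => ?_)
      (h₁.sum_card_le (one_le_inside V) h₁.mem_of_inside)
    split_ifs with hx
    · obtain ⟨γ, h₃, h₄, h₅⟩ := hx
      rwa [exec_eq_of_isStable (one_le_inside V) h₁ h₃ h₂ h₄]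
    · exact Nat.zero_le _
  · push Not at h
    simp [h]

/-! ### Product measures -/

section Product

variable {K E Ω Z : Type*} [MeasurableSpace E] [MeasurableSpace Ω]

/-- Membership in `A` depends only on the coordinates in `S`. -/
def DeterminedBy (S : Set K) (A : Set (K → E)) : Prop :=
  ∀ f g : K → E, (∀ k ∈ S, f k = g k) → (f ∈ A ↔ g ∈ A)

/-- The set is its own preimage under the map that freezes all coordinates outside `S`, and this map
is measurable for the coordinates in `S`. -/
theorem DeterminedBy.measurableSet [Nonempty E] {S : Set K} {A : Set (K → E)}
    (h : DeterminedBy S A) (hA : MeasurableSet A) :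
    MeasurableSet[⨆ k ∈ S, MeasurableSpace.comap (fun f : K → E => f k) inferInstance] A := by
  classical
  let c : E := Classical.arbitrary E
  let ρ : (K → E) → K → E := fun f k => if k ∈ S then f k else c
  have hρ : @Measurable _ _ (⨆ k ∈ S, MeasurableSpace.comap (fun f : K → E => f k) inferInstance)
      MeasurableSpace.pi ρ := by
    refine @measurable_pi_lambda _ _ _ (_) _ _ fun k => ?_
    by_cases hk : k ∈ S
    · simp only [ρ, if_pos hk]
      exact (comap_measurable _).mono (le_iSup₂_of_le k hk le_rfl) le_rfl
    · simp only [ρ, if_neg hk]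
      exact @measurable_const _ _ _ (_) _
  have : A = ρ ⁻¹' A := by
    ext f
    exact h _ _ fun k hk => by simp [ρ, hk]
  rw [this]
  exact hρ hA

variable (μ₀ : Measure E) [IsProbabilityMeasure μ₀]

/-- Events that are determined by disjoint sets of coordinates are independent. -/
theorem infinitePi_inter {S T : Set K} (hST : Disjoint S T) {A B : Set (K → E)}
    (hA : MeasurableSet A) (hB : MeasurableSet B) (hAS : DeterminedBy S A)
    (hBT : DeterminedBy T B) :
    Measure.infinitePi (fun _ : K => μ₀) (A ∩ B) =
      Measure.infinitePi (fun _ : K => μ₀) A * Measure.infinitePi (fun _ : K => μ₀) B := by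
  have : Nonempty E := nonempty_of_isProbabilityMeasure μ₀
  have hind : iIndepFun (fun (k : K) (f : K → E) => f k) (Measure.infinitePi fun _ : K => μ₀) :=
    iIndepFun_infinitePi (P := fun _ : K => μ₀) (X := fun _ e => e) fun _ => measurable_id
  have := indep_iSup_of_disjoint (fun k => (measurable_pi_apply k).comap_le)
    ((iIndepFun_iff_iIndep _ _ _).1 hind) hST
  exact (Indep_iff _ _ _).1 this A B (hAS.measurableSet hA) (hBT.measurableSet hB)

theorem measurePreserving_comp {e : K → K} (he : Function.Injective e) :
    MeasurePreserving (fun f : K → E => f ∘ e) (Measure.infinitePi fun _ : K => μ₀)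
      (Measure.infinitePi fun _ : K => μ₀) := by
  have hind : iIndepFun (fun (k : K) (f : K → E) => f k) (Measure.infinitePi fun _ : K => μ₀) :=
    iIndepFun_infinitePi (P := fun _ : K => μ₀) (X := fun _ e => e) fun _ => measurable_id
  refine ⟨by fun_prop, ?_⟩
  have := (hind.precomp he).map_fun_eq_infinitePi_map fun k => measurable_pi_apply _
  simpa [Measure.infinitePi_map_eval, Function.comp_def] using this

/-- Events of `Ω × (K → E)` that involve finitely many coordinates. -/
def cylinderEvents (Ω K E : Type*) [MeasurableSpace Ω] [MeasurableSpace E] :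
    Set (Set (Ω × (K → E))) :=
  {B | MeasurableSet B ∧ ∃ F : Finset K, ∀ η, DeterminedBy (F : Set K) (Prod.mk η ⁻¹' B)}

theorem isSetAlgebra_cylinderEvents : IsSetAlgebra (cylinderEvents Ω K E) where
  empty_mem := ⟨MeasurableSet.empty, ∅, fun _ _ _ _ => Iff.rfl⟩
  compl_mem := fun _ ⟨h, F, hF⟩ => ⟨h.compl, F, fun η f g hfg => not_congr (hF η f g hfg)⟩
  union_mem := fun _ _ ⟨h, F, hF⟩ ⟨h', F', hF'⟩ => by
    classical
    refine ⟨h.union h', F ∪ F', fun η f g hfg => or_congr (hF η f g fun k hk => hfg k ?_)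
      (hF' η f g fun k hk => hfg k ?_)⟩
    · simp [Finset.mem_coe.1 hk]
    · simp [Finset.mem_coe.1 hk]

theorem generateFrom_cylinderEvents :
    (inferInstance : MeasurableSpace (Ω × (K → E))) =
      MeasurableSpace.generateFrom (cylinderEvents Ω K E) := by
  refine le_antisymm ?_ (MeasurableSpace.generateFrom_le fun B hB => hB.1)
  refine sup_le ?_ ?_
  · rintro _ ⟨B, hB, rfl⟩
    exact MeasurableSpace.measurableSet_generateFrom
      ⟨measurable_fst hB, ∅, fun _ _ _ _ => Iff.rfl⟩
  · rw [MeasurableSpace.pi, MeasurableSpace.comap_iSup]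
    refine iSup_le fun k => ?_
    rintro _ ⟨_, ⟨B, hB, rfl⟩, rfl⟩
    refine MeasurableSpace.measurableSet_generateFrom
      ⟨measurable_snd (measurable_pi_apply k hB), {k}, fun η f g h => ?_⟩
    simp [h k (by simp)]

/-- **Zero-one law.** An ergodic action times an independent i.i.d. field is ergodic. -/
theorem prod_infinitePi_zero_one (ν : Measure Ω) [IsProbabilityMeasure ν] {S : Z → Ω → Ω}
    (hS : ∀ z, MeasurePreserving (S z) ν ν)
    (herg : ∀ A : Set Ω, MeasurableSet A → (∀ z, S z ⁻¹' A = A) → ν A = 0 ∨ ν A = 1)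
    {e : Z → K → K} (he : ∀ z, Function.Injective (e z))
    (hfar : ∀ F : Finset K, ∃ z, Disjoint (F : Set K) (e z '' F)) {A : Set (Ω × (K → E))}
    (hA : MeasurableSet A) (hinv : ∀ z ω, ω ∈ A ↔ (S z ω.1, ω.2 ∘ e z) ∈ A) :
    ν.prod (Measure.infinitePi fun _ : K => μ₀) A = 0 ∨
      ν.prod (Measure.infinitePi fun _ : K => μ₀) A = 1 := by
  set μ := Measure.infinitePi fun _ : K => μ₀ with hμ
  -- The conditional probability of `A` given the first component. It is invariant, so once it is
  -- shown to be 0 or 1 almost everywhere, ergodicity of `ν` makes it constant.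
  let g : Ω → ℝ := fun η => μ.real (Prod.mk η ⁻¹' A)
  have hgm : Measurable g := (measurable_measure_prodMk_left hA).ennreal_toReal
  have hpre : ∀ z η (B : Set (Ω × (K → E))), MeasurableSet B →
      μ.real ((fun f => f ∘ e z) ⁻¹' (Prod.mk (S z η) ⁻¹' B)) = μ.real (Prod.mk (S z η) ⁻¹' B) := by
    intro z η B hB
    rw [Measure.real, Measure.real, (measurePreserving_comp μ₀ (he z)).measure_preimage
      (measurable_prodMk_left hB).nullMeasurableSet]
  have hsec : ∀ z η, Prod.mk η ⁻¹' A = (fun f => f ∘ e z) ⁻¹' (Prod.mk (S z η) ⁻¹' A) := by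
    intro z η
    ext f
    exact hinv z (η, f)
  have hginv : ∀ z η, g (S z η) = g η := fun z η => by
    simp only [g]
    rw [hsec z η, hpre z η A hA]
  -- Mixing argument: approximate `A` by a cylinder event `B` and move `B` to disjoint coordinates.
  -- Independence of the two copies makes `g` close to `g * g`; the error `2 * (H η + H (S z η))`
  -- integrates to at most four times `ε / 4`.
  have hkey : ∫⁻ η, ENNReal.ofReal |g η - g η * g η| ∂ν = 0 := by
    refine nonpos_iff_eq_zero.1 (ENNReal.le_of_forall_pos_le_add fun ε hε _ => ?_)
    obtain ⟨B, hB, hAB⟩ := (Measure.MeasureDense.of_generateFrom_isSetAlgebra_finite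
      (μ := ν.prod μ) isSetAlgebra_cylinderEvents generateFrom_cylinderEvents).approx A hA
      (measure_ne_top _ _) (ε / 4) (by positivity)
    obtain ⟨hBm, F, hF⟩ := hB
    obtain ⟨z, hz⟩ := hfar F
    have hDm : MeasurableSet (symmDiff A B) := hA.symmDiff hBm
    let H : Ω → ℝ≥0∞ := fun η => μ (Prod.mk η ⁻¹' symmDiff A B)
    have hHm : Measurable H := measurable_measure_prodMk_left hDm
    have hH : ∫⁻ η, H η ∂ν ≤ ENNReal.ofReal (ε / 4) := by
      rw [← Measure.prod_apply hDm]; exact hAB.le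
    have hpt : ∀ η, ENNReal.ofReal |g η - g η * g η| ≤ 2 * (H η + H (S z η)) := by
      intro η
      have hb : |g η - μ.real (Prod.mk η ⁻¹' B)| ≤ (H η).toReal :=
        abs_measureReal_sub_le_measureReal_symmDiff
          (measurable_prodMk_left hA).nullMeasurableSet
          (measurable_prodMk_left hBm).nullMeasurableSet
      have hb' : |g η - μ.real (Prod.mk (S z η) ⁻¹' B)| ≤ (H (S z η)).toReal := by
        rw [← hginv z η]
        exact abs_measureReal_sub_le_measureReal_symmDiff
          (measurable_prodMk_left hA).nullMeasurableSet
          (measurable_prodMk_left hBm).nullMeasurableSet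
      have hcm := (measurePreserving_comp μ₀ (he z)).measurable
      -- By invariance the section of `A` equals its intersection with its own translate, which is
      -- compared with that of `B`.
      have hc : |g η - μ.real (Prod.mk η ⁻¹' B ∩
          (fun f => f ∘ e z) ⁻¹' (Prod.mk (S z η) ⁻¹' B))| ≤ (H η).toReal + (H (S z η)).toReal := by
        have h₁ : g η = μ.real (Prod.mk η ⁻¹' A ∩
            (fun f => f ∘ e z) ⁻¹' (Prod.mk (S z η) ⁻¹' A)) := by
          rw [← hsec, Set.inter_self]
        rw [h₁]
        refine (abs_measureReal_sub_le_measureReal_symmDiff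
          ((measurable_prodMk_left hA).inter
            (hcm (measurable_prodMk_left hA))).nullMeasurableSet
          ((measurable_prodMk_left hBm).inter
            (hcm (measurable_prodMk_left hBm))).nullMeasurableSet).trans ?_
        have h₂ := hpre z η _ hDm
        change _ = (H (S z η)).toReal at h₂
        rw [← h₂]
        refine le_trans (measureReal_mono ?_) (measureReal_union_le _ _)
        intro f
        simp only [Set.mem_symmDiff, Set.mem_inter_iff, Set.mem_preimage, Set.mem_union]
        tauto
      have hind : μ.real (Prod.mk η ⁻¹' B ∩
          (fun f => f ∘ e z) ⁻¹' (Prod.mk (S z η) ⁻¹' B)) =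
          μ.real (Prod.mk η ⁻¹' B) * μ.real (Prod.mk (S z η) ⁻¹' B) := by
        rw [← hpre z η B hBm]
        simp only [Measure.real, ← ENNReal.toReal_mul]
        rw [hμ, infinitePi_inter μ₀ hz (measurable_prodMk_left hBm)
          (hcm (measurable_prodMk_left hBm)) (hF η)]
        exact fun f f' hff' => hF (S z η) _ _ fun k hk => hff' _ ⟨k, hk, rfl⟩
      have hfin : ∀ η, H η ≠ ∞ := fun η => measure_ne_top _ _
      rw [← ENNReal.toReal_le_toReal ENNReal.ofReal_ne_top
        (ENNReal.mul_ne_top (by simp) (ENNReal.add_ne_top.2 ⟨hfin _, hfin _⟩)),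
        ENNReal.toReal_ofReal (abs_nonneg _), ENNReal.toReal_mul,
        ENNReal.toReal_add (hfin _) (hfin _)]
      simp only [ENNReal.toReal_ofNat]
      rw [hind] at hc
      set a := g η
      set b := μ.real (Prod.mk η ⁻¹' B)
      set b' := μ.real (Prod.mk (S z η) ⁻¹' B)
      have ha : |a| ≤ 1 := by
        rw [abs_of_nonneg measureReal_nonneg]; exact measureReal_le_one
      have hb1 : |b| ≤ 1 := by
        rw [abs_of_nonneg measureReal_nonneg]; exact measureReal_le_one
      calc |a - a * a| = |(a - b * b') - (b * (a - b') + a * (a - b))| := by congr 1; ring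
        _ ≤ |a - b * b'| + |b * (a - b') + a * (a - b)| := abs_sub _ _
        _ ≤ |a - b * b'| + (|b * (a - b')| + |a * (a - b)|) := by gcongr; exact abs_add_le _ _
        _ ≤ ((H η).toReal + (H (S z η)).toReal) + (1 * (H (S z η)).toReal + 1 * (H η).toReal) := by
          rw [abs_mul, abs_mul]; gcongr
        _ = 2 * ((H η).toReal + (H (S z η)).toReal) := by ring
    calc ∫⁻ η, ENNReal.ofReal |g η - g η * g η| ∂ν ≤ ∫⁻ η, 2 * (H η + H (S z η)) ∂ν :=
          lintegral_mono hpt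
      _ = 2 * (∫⁻ η, H η ∂ν + ∫⁻ η, H η ∂ν) := by
          rw [lintegral_const_mul (f := fun η => H η + H (S z η)) _
              (hHm.add (hHm.comp (hS z).measurable)),
            lintegral_add_left hHm, (hS z).lintegral_comp hHm]
      _ ≤ 2 * (ENNReal.ofReal (ε / 4) + ENNReal.ofReal (ε / 4)) := by gcongr
      _ = 0 + ε := by
          rw [← ENNReal.ofReal_add (by positivity) (by positivity),
            show (2 : ℝ≥0∞) = ENNReal.ofReal 2 by simp, ← ENNReal.ofReal_mul (by norm_num), zero_add]
          rw [show (2 : ℝ) * (ε / 4 + ε / 4) = ε by ring, ENNReal.ofReal_coe_nnreal]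
  have hae : ∀ᵐ η ∂ν, g η = 0 ∨ g η = 1 := by
    have := (lintegral_eq_zero_iff (by fun_prop)).1 hkey
    filter_upwards [this] with η hη
    have h0 : |g η - g η * g η| = 0 := le_antisymm (by simpa using hη) (abs_nonneg _)
    have h1 : g η * (1 - g η) = 0 := by
      have := abs_eq_zero.1 h0; linarith
    rcases mul_eq_zero.1 h1 with h | h
    · exact Or.inl h
    · exact Or.inr (by linarith)
  have hPA : ν.prod μ A = ∫⁻ η, ENNReal.ofReal (g η) ∂ν := by
    rw [Measure.prod_apply hA]
    exact lintegral_congr fun η => by simp [g]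
  rcases herg (g ⁻¹' {1}) (hgm (measurableSet_singleton _)) (fun z => by
    ext η; simp [hginv]) with h | h
  · left
    rw [hPA, lintegral_eq_zero_iff (by fun_prop)]
    filter_upwards [hae, measure_eq_zero_iff_ae_notMem.1 h] with η h₁ h₂
    rcases h₁ with h₁ | h₁
    · simp [h₁]
    · exact absurd h₁ h₂
  · right
    have : ∀ᵐ η ∂ν, g η = 1 := by
      rwa [← mem_ae_iff_prob_eq_one (hgm (measurableSet_singleton _))] at h
    rw [hPA, lintegral_congr_ae (g := fun _ => 1)]
    · simp
    · filter_upwards [this] with η hη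
      simp [hη]

end Product

section

/-! ### Measurability -/

instance : DiscreteMeasurableSpace Occ := ⟨fun _ => trivial⟩

instance : DiscreteMeasurableSpace (Instr d) := ⟨fun _ => trivial⟩

instance : Countable Occ := by
  refine Function.Injective.countable (f := fun a : Occ => (a.numActive, a.card)) fun a b h => ?_
  cases a <;> cases b <;> simp_all [Occ.numActive, Occ.card] <;> omega

instance : Countable (Instr d) := by
  refine Function.Injective.countable
    (f := fun i : Instr d => (match i with
      | .sleep => none
      | .jump z => some z : Option (Site d))) fun a b h => ?_
  cases a <;> cases b <;> simp_all

theorem measurable_topple (x : Site d) (i : Instr d) :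
    Measurable (topple x i : Config d → Config d) := by
  have hop : ∀ (f : Occ → Occ) (y : Site d),
      Measurable fun η : Config d => Function.update η y (f (η y)) := by
    intro f y
    refine measurable_pi_lambda _ fun w => ?_
    by_cases h : w = y
    · subst h
      simpa [Function.comp_def] using (measurable_of_countable f).comp (measurable_pi_apply w)
    · simpa [h] using measurable_pi_apply w
  cases i with
  | sleep => exact hop Occ.trySleep x
  | jump z => exact (hop Occ.add (x + z)).comp (hop Occ.remove x)

section

variable {Ω : Type*} [MeasurableSpace Ω] {I : Ω → Stack d}

theorem measurable_topple_comp {C : Ω → Config d} (hI : Measurable I) (hC : Measurable C)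
    (x : Site d) (k : Site d × ℕ) : Measurable fun ω => topple x (I ω k) (C ω) := by
  have : Measurable fun q : Instr d × Config d => topple x q.1 q.2 :=
    measurable_from_prod_countable_right fun i => measurable_topple x i
  exact this.comp (((measurable_pi_apply k).comp hI).prodMk hC)

/-- For a fixed list the positions of the instructions read are deterministic. Events about some
sequence are then countable unions over lists. -/
theorem measurable_exec (hI : Measurable I) (α : List (Site d)) :
    ∀ {C : Ω → Config d}, Measurable C → ∀ m : Site d → ℕ,
      Measurable fun ω => (exec (I ω) α (C ω, m)).1 := by
  induction α with
  | nil => exact fun hC _ => hC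
  | cons x α ih =>
    exact fun hC m => ih (measurable_topple_comp hI hC x (x, m x))
      (Function.update m x (m x + 1))

theorem measurableSet_numActive {C : Ω → Config d} (hC : Measurable C) (x : Site d)
    (P : ℕ → Prop) : MeasurableSet {ω | P (C ω x).numActive} :=
  ((measurable_pi_apply x).comp hC) (MeasurableSet.of_discrete (s := {a : Occ | P a.numActive}))

theorem measurableSet_legal (θ : Site d → ℕ∞) (hI : Measurable I) (α : List (Site d)) :
    ∀ {C : Ω → Config d}, Measurable C → ∀ m : Site d → ℕ,
      MeasurableSet {ω | Legal θ (I ω) α (C ω, m)} := by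
  induction α with
  | nil => exact fun _ _ => by simp [Legal]
  | cons x α ih =>
    exact fun hC m => (measurableSet_numActive hC x fun n => θ x ≤ n).inter
      (ih (measurable_topple_comp hI hC x (x, m x)) (Function.update m x (m x + 1)))

theorem measurableSet_isStable (θ : Site d → ℕ∞) (hI : Measurable I) {C : Ω → Config d}
    (hC : Measurable C) (α : List (Site d)) (m : Site d → ℕ) :
    MeasurableSet {ω | IsStable θ (exec (I ω) α (C ω, m))} := by
  simp only [IsStable, Set.ofPred_forall]
  exact MeasurableSet.iInter fun x =>
    measurableSet_numActive (measurable_exec hI α hC m) x fun n => ¬ θ x ≤ n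

theorem measurableSet_reaches (θ : Site d → ℕ∞) (hI : Measurable I) {C : Ω → Config d}
    (hC : Measurable C) (x : Site d) (n : ℕ) :
    MeasurableSet {ω | Reaches θ (I ω) (C ω) x n} := by
  simp only [Reaches, Set.ofPred_exists, Set.ofPred_and]
  exact MeasurableSet.iUnion fun α => (measurableSet_legal θ hI α hC 0).inter (.const _)

end

theorem measurableSet_weaklyOccupied (V : Finset (Site d)) (η : Config d) (x : Site d) (j : ℕ) :
    MeasurableSet {ι : Stack d | WeaklyOccupied V η x j ι} := by
  simp only [WeaklyOccupied, Set.ofPred_exists, Set.ofPred_and]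
  have hC : Measurable fun _ : Stack d => η := measurable_const
  exact MeasurableSet.iUnion fun α => (measurableSet_legal _ measurable_id α hC 0).inter
    ((measurableSet_isStable _ measurable_id hC α 0).inter
      ((measurableSet_numActive (measurable_exec measurable_id α hC 0) x fun n => 1 ≤ n).inter
        (.const _)))

theorem measurableSet_occupied (V : Finset (Site d)) (η : Config d) (x : Site d) :
    MeasurableSet {ι : Stack d | Occupied V η x ι} := by
  simp only [Occupied, Set.ofPred_exists, Set.ofPred_and]
  have hC : Measurable fun _ : Stack d => η := measurable_const
  exact MeasurableSet.iUnion fun α => (measurableSet_legal _ measurable_id α hC 0).inter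
    ((measurableSet_isStable _ measurable_id hC α 0).inter
      (((measurable_pi_apply x).comp (measurable_exec measurable_id α hC 0))
        (MeasurableSet.of_discrete (s := {a : Occ | 1 ≤ a.card}))))

/-! ### The law of the stacks -/

/-- The law of the stacks of instructions. -/
def stackLaw (p : PMF (Site d)) (lam : ℝ≥0) : Measure (Stack d) :=
  Measure.infinitePi fun _ : Site d × ℕ => instrLaw p lam

instance (p : PMF (Site d)) (lam : ℝ≥0) : IsProbabilityMeasure (stackLaw p lam) := by
  unfold stackLaw; infer_instance

variable (p : PMF (Site d)) (lam : ℝ≥0)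

theorem instrLaw_sleep : instrLaw p lam {Instr.sleep} = ((lam / (1 + lam) : ℝ≥0) : ℝ≥0∞) := by
  have hm : Measurable (Instr.jump : Site d → Instr d) := measurable_of_countable _
  have : (Instr.jump : Site d → Instr d) ⁻¹' {Instr.sleep} = ∅ := by ext; simp
  simp [instrLaw, Measure.map_apply hm, this, ENNReal.smul_def]

theorem instrLaw_jump_ne_zero {z : Site d} (hz : z ∈ p.support) :
    instrLaw p lam {Instr.jump z} ≠ 0 := by
  have hm : Measurable (Instr.jump : Site d → Instr d) := measurable_of_countable _
  have : (Instr.jump : Site d → Instr d) ⁻¹' {Instr.jump z} = {z} := by ext; simp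
  have hne : (1 / (1 + lam) : ℝ≥0) ≠ 0 := by positivity
  have hz' : p z ≠ 0 := hz
  simp only [instrLaw, Measure.add_apply, Measure.smul_apply, Measure.map_apply hm
    (measurableSet_singleton _), this, ENNReal.smul_def, smul_eq_mul,
    PMF.toMeasure_apply_singleton p z (measurableSet_singleton z)]
  intro h
  have := (add_eq_zero.1 h).2
  rcases mul_eq_zero.1 this with h | h
  · exact hne (by exact_mod_cast h)
  · exact hz' h

/-- Second Borel–Cantelli lemma, for countably many sites and jumps. -/
theorem ae_rich : ∀ᵐ ι ∂stackLaw p lam, Rich p.support ι := by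
  unfold Rich
  rw [ae_all_iff]
  intro x
  rw [ae_ball_iff (Set.to_countable _)]
  intro z hz
  have hind : iIndepFun (fun (k : Site d × ℕ) (f : Stack d) => f k) (stackLaw p lam) :=
    iIndepFun_infinitePi (P := fun _ : Site d × ℕ => instrLaw p lam) (X := fun _ e => e)
      fun _ => measurable_id
  have hms : ∀ n : ℕ, MeasurableSet {ι : Stack d | ι (x, n) = Instr.jump z} := fun n =>
    (measurable_pi_apply (x, n) : Measurable fun ι : Stack d => ι (x, n))
      (measurableSet_singleton (Instr.jump z))
  have hset : iIndepSet (fun n : ℕ => {ι : Stack d | ι (x, n) = Instr.jump z})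
      (stackLaw p lam) := by
    have h₁ := hind.precomp (g := fun n : ℕ => (x, n)) fun a b h => by simpa using h
    rw [iIndepSet_iff_meas_biInter hms]
    intro S
    exact h₁.measure_inter_preimage_eq_mul S (sets := fun _ => {Instr.jump z})
      fun _ _ => measurableSet_singleton _
  have hmeas : ∀ n : ℕ, stackLaw p lam {ι : Stack d | ι (x, n) = Instr.jump z} =
      instrLaw p lam {Instr.jump z} := fun n => by
    have := (measurePreserving_eval_infinitePi (fun _ : Site d × ℕ => instrLaw p lam)
      (x, n)).measure_preimage (measurableSet_singleton (Instr.jump z)).nullMeasurableSet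
    exact this
  have hlim := measure_limsup_eq_one hms hset (by
    simp_rw [hmeas]
    exact ENNReal.tsum_const_eq_top_of_ne_zero (instrLaw_jump_ne_zero p lam hz))
  rw [← mem_ae_iff_prob_eq_one (MeasurableSet.measurableSet_limsup hms)] at hlim
  filter_upwards [hlim] with ι hι
  rw [mem_limsup_iff_frequently_mem] at hι
  exact hι

variable {p}

/-- A site that is toppled in the stabilization of `V` keeps a particle with probability at least
`lam / (1 + lam)`. -/
theorem mul_measure_reaches_le {z : Site d} (hz : z ∈ p.support) (hz₀ : z ≠ 0)
    {V : Finset (Site d)} (η : Config d) {x : Site d} (hx : x ∈ V) :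
    ((lam / (1 + lam) : ℝ≥0) : ℝ≥0∞) * stackLaw p lam {ι | Reaches (inside V) ι η x 1} ≤
      stackLaw p lam {ι | Occupied V η x ι} := by
  -- `A j` does not involve the instruction `(x, j)`, and `B j` involves nothing else.
  let A : ℕ → Set (Stack d) := fun j => {ι | WeaklyOccupied V η x j ι}
  let B : ℕ → Set (Stack d) := fun j => (fun ι => ι (x, j)) ⁻¹' {Instr.sleep}
  have hA : ∀ j, MeasurableSet (A j) := measurableSet_weaklyOccupied V η x
  have hB : ∀ j, MeasurableSet (B j) := fun j =>
    measurable_pi_apply _ (measurableSet_singleton _)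
  have hAB : ∀ j, stackLaw p lam (A j ∩ B j) =
      ((lam / (1 + lam) : ℝ≥0) : ℝ≥0∞) * stackLaw p lam (A j) := by
    intro j
    have h₁ : stackLaw p lam (B j) = ((lam / (1 + lam) : ℝ≥0) : ℝ≥0∞) := by
      rw [← instrLaw_sleep p lam]
      exact (measurePreserving_eval_infinitePi (fun _ : Site d × ℕ => instrLaw p lam)
        (x, j)).measure_preimage (measurableSet_singleton _).nullMeasurableSet
    rw [← h₁, mul_comm]
    refine infinitePi_inter (instrLaw p lam) (S := {(x, j)}ᶜ) (T := {(x, j)}) disjoint_compl_left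
      (hA j) (hB j) (fun ι ι' h => ⟨fun hw => hw.congr h, fun hw => hw.congr fun k hk => ?_⟩)
      (fun ι ι' h => ?_)
    · exact (h k hk).symm
    · simp [B, h (x, j) rfl]
  calc ((lam / (1 + lam) : ℝ≥0) : ℝ≥0∞) * stackLaw p lam {ι | Reaches (inside V) ι η x 1}
      ≤ ((lam / (1 + lam) : ℝ≥0) : ℝ≥0∞) * ∑' j, stackLaw p lam (A j) := by
        gcongr
        refine (measure_mono_ae ?_).trans (measure_iUnion_le A)
        filter_upwards [ae_rich p lam] with ι hι hr
        exact Set.mem_iUnion.2 (hι.exists_weaklyOccupied hz hz₀ hx hr)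
    _ = ∑' j, stackLaw p lam (A j ∩ B j) := by
        rw [← ENNReal.tsum_mul_left]
        exact tsum_congr fun j => (hAB j).symm
    _ = stackLaw p lam (⋃ j, A j ∩ B j) := by
        rw [measure_iUnion _ fun j => (hA j).inter (hB j)]
        intro i j hij
        rw [Function.onFun, Set.disjoint_left]
        exact fun ι h h' => hij (h.1.unique hx h'.1)
    _ ≤ _ := measure_mono <| Set.iUnion_subset fun j ι h => h.1.occupied hx h.2

/-- The expected number of sites toppled in the stabilization of `V` is at most
`(1 + lam) / lam` times the number of particles. -/
theorem sum_measure_reaches_le {z : Site d} (hz : z ∈ p.support) (hz₀ : z ≠ 0)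
    (V : Finset (Site d)) (η : Config d) :
    ((lam / (1 + lam) : ℝ≥0) : ℝ≥0∞) *
        ∑ x ∈ V, stackLaw p lam {ι | Reaches (inside V) ι η x 1} ≤
      ∑ x ∈ V, ((η x).card : ℝ≥0∞) := by
  classical
  rw [Finset.mul_sum]
  calc _ ≤ ∑ x ∈ V, stackLaw p lam {ι | Occupied V η x ι} :=
        Finset.sum_le_sum fun x hx => mul_measure_reaches_le lam hz hz₀ η hx
    _ = ∫⁻ ι, ∑ x ∈ V, {ι | Occupied V η x ι}.indicator 1 ι ∂stackLaw p lam := by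
        rw [lintegral_finsetSum _ fun x _ =>
          measurable_one.indicator (measurableSet_occupied V η x)]
        exact Finset.sum_congr rfl fun x _ =>
          (lintegral_indicator_one (measurableSet_occupied V η x)).symm
    _ ≤ ∫⁻ _, ∑ x ∈ V, ((η x).card : ℝ≥0∞) ∂stackLaw p lam := by
        refine lintegral_mono fun ι => ?_
        have := sum_occupied_le V η ι
        simp only [Set.indicator_apply, Set.mem_ofPred_eq, Pi.one_apply]
        exact_mod_cast this
    _ = _ := by simp

end

section

/-! ### Boxes -/

/-- The box `{-n, …, n}^d`. -/
def box (d n : ℕ) : Finset (Site d) := Fintype.piFinset fun _ => Finset.Icc (-(n : ℤ)) n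

theorem mem_box {n : ℕ} {x : Site d} : x ∈ box d n ↔ ∀ i, |x i| ≤ (n : ℤ) := by
  simp [box, abs_le]

theorem box_mono : Monotone (box d) := fun m n h x hx =>
  mem_box.2 fun i => (mem_box.1 hx i).trans (by exact_mod_cast h)

theorem exists_mem_box (x : Site d) : ∃ n, x ∈ box d n :=
  ⟨∑ i, (x i).natAbs, mem_box.2 fun i => by
    rw [Int.abs_eq_natAbs]
    exact_mod_cast Finset.single_le_sum (f := fun i => (x i).natAbs) (fun _ _ => Nat.zero_le _)
      (Finset.mem_univ i)⟩

theorem card_box (d n : ℕ) : (box d n).card = (2 * n + 1) ^ d := by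
  simp only [box, Fintype.card_piFinset, Int.card_Icc, Finset.prod_const, Finset.card_univ,
    Fintype.card_fin]
  congr 1; omega

theorem add_mem_box {m n : ℕ} {x y : Site d} (hx : x ∈ box d m) (hy : y ∈ box d n) :
    x + y ∈ box d (m + n) := mem_box.2 fun i => by
  push_cast
  exact (abs_add_le _ _).trans (add_le_add (mem_box.1 hx i) (mem_box.1 hy i))

/-! ### Finitely many particles -/

variable {p : PMF (Site d)} (lam : ℝ≥0)

theorem tendsto_measure_reaches {Ω : Type*} [MeasurableSpace Ω] (P : Measure Ω)
    (C : Ω → Config d) (I : Ω → Stack d) (x : Site d) (n : ℕ) :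
    Tendsto (fun r => P {ω | Reaches (inside (box d r)) (I ω) (C ω) x n}) atTop
      (𝓝 (P {ω | Reaches 1 (I ω) (C ω) x n})) := by
  have h : {ω | Reaches 1 (I ω) (C ω) x n} =
      ⋃ r, {ω | Reaches (inside (box d r)) (I ω) (C ω) x n} := by
    ext ω
    simp [reaches_one_iff box_mono exists_mem_box]
  rw [h]
  refine tendsto_measure_iUnion_atTop fun r r' hr ω hω => Reaches.mono (fun y => ?_) hω
  unfold inside
  split_ifs with h₁ h₂ h₂
  · rfl
  · simp
  · exact absurd (box_mono hr h₂) h₁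
  · rfl

/-- A system with finitely many particles visits finitely many sites. -/
theorem ae_finite_visited (hlam : 0 < lam) {z : Site d} (hz : z ∈ p.support) (hz₀ : z ≠ 0)
    {η : Config d} {D : Finset (Site d)} (hD : ∀ x ∉ D, (η x).card = 0) :
    ∀ᵐ ι ∂stackLaw p lam, {x | Reaches 1 ι η x 1}.Finite := by
  have hc : ((lam / (1 + lam) : ℝ≥0) : ℝ≥0∞) ≠ 0 := by
    have : (lam / (1 + lam) : ℝ≥0) ≠ 0 := by positivity
    exact_mod_cast this
  set k : ℝ≥0∞ := ∑ x ∈ D, ((η x).card : ℝ≥0∞)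
  have hk : k ≠ ∞ := ENNReal.sum_ne_top.2 fun x _ => ENNReal.natCast_ne_top _
  -- Apply the bound for finite sets in a box containing `W`, where there are at most `k` particles,
  -- and let the box grow.
  have hbound : ∀ W : Finset (Site d),
      ((lam / (1 + lam) : ℝ≥0) : ℝ≥0∞) * ∑ x ∈ W, stackLaw p lam {ι | Reaches 1 ι η x 1} ≤ k := by
    intro W
    have ht : Tendsto (fun r => ((lam / (1 + lam) : ℝ≥0) : ℝ≥0∞) *
        ∑ x ∈ W, stackLaw p lam {ι | Reaches (inside (box d r)) ι η x 1}) atTop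
        (𝓝 (((lam / (1 + lam) : ℝ≥0) : ℝ≥0∞) *
          ∑ x ∈ W, stackLaw p lam {ι | Reaches 1 ι η x 1})) :=
      ENNReal.Tendsto.const_mul (tendsto_finsetSum _ fun x _ =>
        tendsto_measure_reaches (stackLaw p lam) (fun _ => η) id x 1) (Or.inr ENNReal.coe_ne_top)
    choose r hr using fun x : Site d => exists_mem_box x
    refine le_of_tendsto ht (eventually_atTop.2 ⟨W.sup r, fun n hn => ?_⟩)
    have hW : W ⊆ box d n := fun x hx => box_mono ((Finset.le_sup hx).trans hn) (hr x)
    calc _ ≤ ((lam / (1 + lam) : ℝ≥0) : ℝ≥0∞) *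
          ∑ x ∈ box d n, stackLaw p lam {ι | Reaches (inside (box d n)) ι η x 1} := by
          gcongr
      _ ≤ ∑ x ∈ box d n, ((η x).card : ℝ≥0∞) := sum_measure_reaches_le lam hz hz₀ _ η
      _ ≤ k := by
          classical
          refine Finset.sum_le_sum_of_ne_zero fun x _ hx => ?_
          by_contra h
          exact hx (by simp [hD x h])
  -- First Borel–Cantelli lemma: the probabilities of being visited have a finite sum.
  refine ae_finite_setOfPred_mem (s := fun x => {ι | Reaches 1 ι η x 1}) ?_
  have : ((lam / (1 + lam) : ℝ≥0) : ℝ≥0∞) *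
      ∑' x, stackLaw p lam {ι | Reaches 1 ι η x 1} ≤ k := by
    rw [ENNReal.tsum_eq_iSup_sum, ENNReal.mul_iSup]
    exact iSup_le hbound
  intro htop
  rw [htop, ENNReal.mul_top hc, top_le_iff] at this
  exact hk this

/-! ### Translation invariance -/

theorem reaches_shift {θ θ' : Site d → ℕ∞} {ι : Stack d} {η : Config d} {x z : Site d} {n : ℕ}
    (hθ : ∀ y, θ' y = θ (y + z)) :
    Reaches θ' (shiftStack z ι) (shift z η) x n ↔ Reaches θ ι η (x + z) n := by
  have hinj : Function.Injective fun y : Site d => y + z := add_left_injective z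
  constructor
  · rintro ⟨α, hα, hn⟩
    refine ⟨α.map (· + z), (legal_shift η 0 hθ).1 hα, ?_⟩
    rwa [List.count_map_of_injective _ _ hinj]
  · rintro ⟨β, hβ, hn⟩
    have hmap : (β.map (· - z)).map (· + z) = β := by simp [Function.comp_def]
    refine ⟨β.map (· - z), (legal_shift η 0 hθ).2 (by rwa [hmap]), ?_⟩
    rw [← hmap, List.count_map_of_injective _ _ hinj] at hn
    exact hn

variable {ν : Measure (Config d)} [IsProbabilityMeasure ν]

theorem measurePreserving_shift (p : PMF (Site d)) (hν : IsTranslationErgodic ν) (z : Site d) :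
    MeasurePreserving (fun ω : Config d × Stack d => (shift z ω.1, shiftStack z ω.2))
      (ν.prod (stackLaw p lam)) (ν.prod (stackLaw p lam)) :=
  (hν.1 z).prod (measurePreserving_comp (instrLaw p lam) (e := fun k => (k.1 + z, k.2))
    fun a b h => by
      simp only [Prod.mk.injEq, add_left_inj] at h
      exact Prod.ext h.1 h.2)

theorem measurableSet_reaches_prod (θ : Site d → ℕ∞) (x : Site d) (n : ℕ) :
    MeasurableSet {ω : Config d × Stack d | Reaches θ ω.2 ω.1 x n} :=
  measurableSet_reaches θ measurable_snd measurable_fst x n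

theorem measure_reaches_shift (hν : IsTranslationErgodic ν) {θ θ' : Site d → ℕ∞} {z : Site d}
    (hθ : ∀ y, θ' y = θ (y + z)) (n : ℕ) :
    ν.prod (stackLaw p lam) {ω | Reaches θ ω.2 ω.1 z n} =
      ν.prod (stackLaw p lam) {ω | Reaches θ' ω.2 ω.1 0 n} := by
  rw [← (measurePreserving_shift lam p hν z).measure_preimage
    (measurableSet_reaches_prod θ' 0 n).nullMeasurableSet]
  congr 1
  ext ω
  simp [reaches_shift hθ]

/-- The probability that the origin is toppled when its neighbourhood is stabilized. -/
theorem mul_measure_reaches_box_le (hν : IsTranslationErgodic ν) {z : Site d}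
    (hz : z ∈ p.support) (hz₀ : z ≠ 0) (n r : ℕ) :
    ((lam / (1 + lam) : ℝ≥0) : ℝ≥0∞) * ((2 * n + 1) ^ d *
        ν.prod (stackLaw p lam) {ω | Reaches (inside (box d r)) ω.2 ω.1 0 1}) ≤
      (2 * (n + r) + 1) ^ d * density ν := by
  have hcard : ∀ m : ℕ, ((box d m).card : ℝ≥0∞) = (2 * m + 1) ^ d := fun m => by
    rw [card_box]; push_cast; rfl
  -- The box of radius `r` around `x` lies in the box of radius `n + r`, and a larger region only
  -- allows more topplings.
  have hterm : ∀ x ∈ box d n,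
      ν.prod (stackLaw p lam) {ω | Reaches (inside (box d r)) ω.2 ω.1 0 1} ≤
        ∫⁻ η, stackLaw p lam {ι | Reaches (inside (box d (n + r))) ι η x 1} ∂ν := by
    intro x hx
    have := Measure.prod_apply (μ := ν) (ν := stackLaw p lam)
      (measurableSet_reaches_prod (inside (box d (n + r))) x 1)
    refine le_trans ?_ this.le
    rw [measure_reaches_shift lam hν (θ' := fun y => inside (box d (n + r)) (y + x)) fun _ => rfl]
    refine measure_mono fun ω hω => Reaches.mono (fun y => ?_) hω
    unfold inside
    split_ifs with h₁ h₂ h₂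
    · rfl
    · simp
    · rw [add_comm y x] at h₁
      exact absurd (add_mem_box hx h₂) h₁
    · rfl
  calc _ = ((lam / (1 + lam) : ℝ≥0) : ℝ≥0∞) * ∑ x ∈ box d n,
        ν.prod (stackLaw p lam) {ω | Reaches (inside (box d r)) ω.2 ω.1 0 1} := by
        rw [Finset.sum_const, nsmul_eq_mul, hcard]
    _ ≤ ((lam / (1 + lam) : ℝ≥0) : ℝ≥0∞) * ∑ x ∈ box d (n + r),
        ∫⁻ η, stackLaw p lam {ι | Reaches (inside (box d (n + r))) ι η x 1} ∂ν := by
        gcongr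
        exact (Finset.sum_le_sum hterm).trans
          (Finset.sum_le_sum_of_subset (box_mono (Nat.le_add_right n r)))
    _ = ∫⁻ η, ((lam / (1 + lam) : ℝ≥0) : ℝ≥0∞) * ∑ x ∈ box d (n + r),
        stackLaw p lam {ι | Reaches (inside (box d (n + r))) ι η x 1} ∂ν := by
        have hm : ∀ x, Measurable fun η =>
            stackLaw p lam {ι | Reaches (inside (box d (n + r))) ι η x 1} := fun x =>
          measurable_measure_prodMk_left
            (measurableSet_reaches_prod (inside (box d (n + r))) x 1)
        rw [lintegral_const_mul _ (Finset.measurable_fun_sum _ fun x _ => hm x),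
          lintegral_finsetSum _ fun x _ => hm x]
    _ ≤ ∫⁻ η, ∑ x ∈ box d (n + r), ((η x).card : ℝ≥0∞) ∂ν :=
        lintegral_mono fun η => sum_measure_reaches_le lam hz hz₀ _ η
    _ = ∑ x ∈ box d (n + r), density ν := by
        have hm : ∀ x, Measurable fun η : Config d => ((η x).card : ℝ≥0∞) := fun x =>
          (measurable_of_countable fun a : Occ => (a.card : ℝ≥0∞)).comp (measurable_pi_apply x)
        rw [lintegral_finsetSum _ fun x _ => hm x]
        refine Finset.sum_congr rfl fun x _ => ?_
        rw [density, ← (hν.1 x).lintegral_comp (hm 0)]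
        simp [shift]
    _ = _ := by rw [Finset.sum_const, nsmul_eq_mul, hcard]; push_cast; rfl

/-- For fixed `r` the boundary layer of width `r` is negligible as `n` tends to infinity; then `r`
tends to infinity. -/
theorem mul_measure_reaches_one_le (hν : IsTranslationErgodic ν) (hfin : density ν ≠ ⊤)
    {z : Site d} (hz : z ∈ p.support) (hz₀ : z ≠ 0) :
    ((lam / (1 + lam) : ℝ≥0) : ℝ≥0∞) *
      ν.prod (stackLaw p lam) {ω | Reaches 1 ω.2 ω.1 0 1} ≤ density ν := by
  refine le_of_tendsto (ENNReal.Tendsto.const_mul (tendsto_measure_reaches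
    (ν.prod (stackLaw p lam)) Prod.fst Prod.snd 0 1) (Or.inr ENNReal.coe_ne_top))
    (Eventually.of_forall fun r => ?_)
  set q := ν.prod (stackLaw p lam) {ω | Reaches (inside (box d r)) ω.2 ω.1 0 1} with hq
  have hqfin : q ≠ ⊤ := measure_ne_top _ _
  rw [← ENNReal.toReal_le_toReal (ENNReal.mul_ne_top ENNReal.coe_ne_top hqfin) hfin]
  have hbound : ∀ n : ℕ, (((lam / (1 + lam) : ℝ≥0) : ℝ≥0∞) * q).toReal ≤
      (1 + 2 * r / (2 * (n : ℝ) + 1)) ^ d * (density ν).toReal := by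
    intro n
    have h := mul_measure_reaches_box_le lam hν hz hz₀ n r
    rw [← hq] at h
    have h' := ENNReal.toReal_mono (ENNReal.mul_ne_top (by finiteness) hfin) h
    simp only [ENNReal.toReal_mul, ENNReal.toReal_pow] at h' ⊢
    have h₁ : ((2 * (n : ℝ≥0∞) + 1).toReal) = 2 * (n : ℝ) + 1 := by
      have : (2 * (n : ℝ≥0∞) + 1) = ((2 * n + 1 : ℕ) : ℝ≥0∞) := by push_cast; rfl
      rw [this, ENNReal.toReal_natCast]; push_cast; rfl
    have h₂ : ((2 * ((n : ℝ≥0∞) + r) + 1).toReal) = 2 * (n : ℝ) + 1 + 2 * r := by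
      have : (2 * ((n : ℝ≥0∞) + r) + 1) = ((2 * (n + r) + 1 : ℕ) : ℝ≥0∞) := by push_cast; rfl
      rw [this, ENNReal.toReal_natCast]; push_cast; ring
    rw [h₁, h₂] at h'
    have hpos : (0 : ℝ) < 2 * n + 1 := by positivity
    rw [show (1 + 2 * (r : ℝ) / (2 * n + 1)) = (2 * n + 1 + 2 * r) / (2 * n + 1) by
      field_simp, div_pow, div_mul_eq_mul_div, le_div_iff₀ (by positivity)]
    linarith
  have hlim : Tendsto (fun n : ℕ => (1 + 2 * r / (2 * (n : ℝ) + 1)) ^ d * (density ν).toReal)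
      atTop (𝓝 ((1 + 0) ^ d * (density ν).toReal)) := by
    refine Tendsto.mul_const _ (Tendsto.pow (tendsto_const_nhds.add ?_) d)
    refine tendsto_const_nhds.div_atTop (tendsto_atTop_add_const_right _ _ ?_)
    exact tendsto_natCast_atTop_atTop.const_mul_atTop (by norm_num)
  simpa using ge_of_tendsto' hlim hbound

theorem exists_disjoint_translate (hd : 0 < d) (F : Finset (Site d)) :
    ∃ z : Site d, ∀ x ∈ F, x + z ∉ F := by
  classical
  have : Nonempty (Fin d) := ⟨⟨0, hd⟩⟩
  obtain ⟨z, hz⟩ := Infinite.exists_notMem_finset ((F ×ˢ F).image fun q => q.2 - q.1)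
  refine ⟨z, fun x hx hxz => hz (Finset.mem_image.2 ⟨(x, x + z), ?_, by simp⟩)⟩
  simp [hx, hxz]

theorem exists_ne_zero_mem_support (hd : 0 < d) (hp : AddSubgroup.closure p.support = ⊤) :
    ∃ z ∈ p.support, z ≠ 0 := by
  by_contra! h
  have : AddSubgroup.closure p.support ≤ ⊥ := (AddSubgroup.closure_le _).2 fun z hz => h z hz
  rw [hp] at this
  have h1 : (fun _ => 1 : Site d) ∈ (⊥ : AddSubgroup (Site d)) := this trivial
  have := congrFun (AddSubgroup.mem_bot.1 h1) ⟨0, hd⟩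
  simp at this

/-- Below density `lam / (1 + lam)` each site is toppled finitely often. -/
theorem ae_exists_not_reaches (hd : 0 < d) (hp : AddSubgroup.closure p.support = ⊤)
    (hν : IsTranslationErgodic ν) (hfin : density ν ≠ ⊤)
    (hdens : density ν < ((lam / (1 + lam) : ℝ≥0) : ℝ≥0∞)) :
    ∀ᵐ ω ∂ν.prod (stackLaw p lam), ∀ x, ∃ n, ¬ Reaches 1 ω.2 ω.1 x n := by
  obtain ⟨z₀, hz₀, hne⟩ := exists_ne_zero_mem_support hd hp
  set P := ν.prod (stackLaw p lam) with hP
  let A : Site d → Set (Config d × Stack d) := fun x => {ω | ∀ n, Reaches 1 ω.2 ω.1 x n}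
  have hA : ∀ x, MeasurableSet (A x) := fun x => by
    simp only [A, Set.ofPred_forall]
    exact MeasurableSet.iInter fun n => measurableSet_reaches_prod 1 x n
  have hshift : ∀ x z ω, ω ∈ A (x + z) ↔ (shift z ω.1, shiftStack z ω.2) ∈ A x := fun x z ω =>
    forall_congr' fun n => (reaches_shift (θ := 1) (θ' := 1) fun _ => rfl).symm
  have hF : P (⋂ x, A x) = 0 := by
    have hlt : P (⋂ x, A x) < 1 := by
      by_contra! hge
      have h₁ : P {ω | Reaches 1 ω.2 ω.1 0 1} = 1 := by
        refine le_antisymm prob_le_one (hge.trans (measure_mono fun ω hω => ?_))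
        exact Set.mem_iInter.1 hω 0 1
      have h₂ := mul_measure_reaches_one_le lam hν hfin hz₀ hne
      rw [← hP, h₁, mul_one] at h₂
      exact absurd h₂ (not_le.2 hdens)
    refine (prod_infinitePi_zero_one (instrLaw p lam) ν (S := shift) hν.1 hν.2
      (e := fun z k => (k.1 + z, k.2)) (fun z a b h => ?_) (fun F => ?_)
      (MeasurableSet.iInter hA) (fun z ω => ?_)).resolve_right hlt.ne
    · simp only [Prod.mk.injEq, add_left_inj] at h
      exact Prod.ext h.1 h.2
    · classical
      obtain ⟨z, hz⟩ := exists_disjoint_translate hd (F.image Prod.fst)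
      refine ⟨z, Set.disjoint_left.2 ?_⟩
      rintro _ hk ⟨k, hk', rfl⟩
      exact hz k.1 (Finset.mem_image_of_mem _ hk') (Finset.mem_image_of_mem _ hk)
    · rw [Set.mem_iInter, Set.mem_iInter]
      change _ ↔ ∀ x, (shift z ω.1, shiftStack z ω.2) ∈ A x
      simp_rw [← hshift]
      exact ⟨fun h x => h _, fun h x => by simpa using h (x - z)⟩
  have hrich : ∀ᵐ ω ∂P, Rich p.support ω.2 :=
    Measure.quasiMeasurePreserving_snd.ae (ae_rich p lam)
  have hstep : ∀ᵐ ω ∂P, ∀ x, ∀ z ∈ p.support, (ω ∈ A x ↔ ω ∈ A (x + z)) := by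
    rw [ae_all_iff]
    intro x
    rw [ae_ball_iff (Set.to_countable _)]
    intro z hz
    -- Jumps give one inclusion only. Both events have the same probability by stationarity, so they
    -- agree almost surely, which also allows steps by `-z`.
    have hsub : A x ≤ᵐ[P] A (x + z) := by
      filter_upwards [hrich] with ω hω h
      exact hω.reaches_add hz h
    have hpre : A (x + z) =
        (fun ω : Config d × Stack d => (shift z ω.1, shiftStack z ω.2)) ⁻¹' A x := by
      ext ω; exact hshift x z ω
    have heq : P (A (x + z)) = P (A x) := by
      rw [hpre]
      exact (measurePreserving_shift lam p hν z).measure_preimage (hA x).nullMeasurableSet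
    exact (ae_eq_of_ae_subset_of_measure_ge hsub heq.le (hA x).nullMeasurableSet
      (measure_ne_top _ _)).mem_iff
  filter_upwards [hstep, measure_eq_zero_iff_ae_notMem.1 hF] with ω hω hF x
  by_contra! hx
  refine hF (Set.mem_iInter.2 fun y => ?_)
  have hgen : y - x ∈ AddSubgroup.closure p.support := by rw [hp]; trivial
  have : ∀ v, ω ∈ A v ↔ ω ∈ A (v + (y - x)) := by
    refine AddSubgroup.closure_induction (p := fun w _ => ∀ v, ω ∈ A v ↔ ω ∈ A (v + w))
      (fun z hz v => hω v z hz) (fun v => by simp) (fun a b _ _ ha hb v => ?_)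
      (fun a _ ha v => ?_) hgen
    · rw [ha v, hb (v + a), add_assoc]
    · rw [ha (v + -a)]; simp
  simpa using (this x).1 hx

end

/-! ### Evolution in continuous time -/

section Evolution

variable {ι : Stack d} {c : Site d × ℕ → ℝ} {ξ : Config d}

theorem stateAfter_succ (n : ℕ) :
    stateAfter ι c ξ (n + 1) = step ι c (stateAfter ι c ξ n) :=
  Function.iterate_succ_apply' _ _ _

theorem step_of_ringsNext {s : State d} (h : ∃ x, RingsNext c s x) :
    ∃ x, RingsNext c s x ∧ step ι c s =
      { config := topple x (ι (x, s.odometer x)) s.config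
        odometer := Function.update s.odometer x (s.odometer x + 1)
        localTime := fun y =>
          s.localTime y + ((s.config y).numActive : ℝ) * (waiting c s x).toReal
        time := s.time + waiting c s x } :=
  ⟨h.choose, h.choose_spec, by rw [step, dif_pos h]⟩

theorem step_of_not_ringsNext {s : State d} (h : ¬ ∃ x, RingsNext c s x) :
    step ι c s = { s with time := ⊤ } := by rw [step, dif_neg h]

theorem RingsNext.one_le_numActive {s : State d} {x : Site d} (h : RingsNext c s x) :
    1 ≤ (s.config x).numActive := by
  by_contra h₀
  exact h.1 (by rw [waiting, if_pos (by omega)])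

theorem exists_ringsNext {s : State d} (hfin : {x | 1 ≤ (s.config x).numActive}.Finite)
    {x : Site d} (hx : 1 ≤ (s.config x).numActive) : ∃ y, RingsNext c s y := by
  obtain ⟨y, hy, hmin⟩ := Set.exists_min_image _ (waiting c s) hfin ⟨x, hx⟩
  have hy' : 1 ≤ (s.config y).numActive := hy
  refine ⟨y, ?_, fun w => ?_⟩
  · rw [waiting, if_neg (by omega)]
    exact ENNReal.ofReal_ne_top
  · by_cases hw : 1 ≤ (s.config w).numActive
    · exact hmin w hw
    · rw [waiting.eq_def c s w, if_pos (by omega)]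
      exact le_top

/-- The link to the discrete theory: the clocks merely choose an order of legal topplings. A finite
time certifies that every step so far was a true toppling. -/
theorem exists_legal_stateAfter (ι : Stack d) (c : Site d × ℕ → ℝ) (ξ : Config d) (n : ℕ) :
    ∃ α, Legal 1 ι α (ξ, 0) ∧
      exec ι α (ξ, 0) = ((stateAfter ι c ξ n).config, (stateAfter ι c ξ n).odometer) ∧
      ((stateAfter ι c ξ n).time ≠ ⊤ → α.length = n) := by
  induction n with
  | zero => exact ⟨[], trivial, rfl, fun _ => rfl⟩
  | succ n ih =>
    obtain ⟨α, h₁, h₂, h₃⟩ := ih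
    rw [stateAfter_succ]
    by_cases h : ∃ x, RingsNext c (stateAfter ι c ξ n) x
    · obtain ⟨x, hx, hs⟩ := step_of_ringsNext (ι := ι) h
      rw [hs]
      refine ⟨α ++ [x], legal_append.2 ⟨h₁, ?_, trivial⟩, ?_, fun ht => ?_⟩
      · rw [h₂, Pi.one_apply]
        exact_mod_cast hx.one_le_numActive
      · rw [exec_append, h₂]
        rfl
      · rw [List.length_append, h₃ fun h => ht (by simp [h])]
        rfl
    · rw [step_of_not_ringsNext h]
      exact ⟨α, h₁, h₂, fun ht => absurd rfl ht⟩

theorem count_eq_odometer {α : List (Site d)} {n : ℕ}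
    (h : exec ι α (ξ, 0) = ((stateAfter ι c ξ n).config, (stateAfter ι c ξ n).odometer))
    (x : Site d) : α.count x = (stateAfter ι c ξ n).odometer x := by
  have := exec_snd (ι := ι) α (ξ, 0) x
  rw [h] at this
  simpa using this.symm

theorem reaches_odometer (n : ℕ) (x : Site d) :
    Reaches 1 ι ξ x ((stateAfter ι c ξ n).odometer x) := by
  obtain ⟨α, h₁, h₂, -⟩ := exists_legal_stateAfter ι c ξ n
  exact ⟨α, h₁, (count_eq_odometer h₂ x).ge⟩

theorem reaches_one_of_active {n : ℕ} {x : Site d}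
    (hx : 1 ≤ ((stateAfter ι c ξ n).config x).numActive) : Reaches 1 ι ξ x 1 := by
  obtain ⟨α, h₁, h₂, -⟩ := exists_legal_stateAfter ι c ξ n
  refine ⟨α ++ [x], legal_append.2 ⟨h₁, ?_, trivial⟩, by simp⟩
  rw [h₂, Pi.one_apply]
  exact_mod_cast hx

theorem odometer_mono (x : Site d) : Monotone fun n => (stateAfter ι c ξ n).odometer x := by
  refine monotone_nat_of_le_succ fun n => ?_
  rw [stateAfter_succ]
  by_cases h : ∃ y, RingsNext c (stateAfter ι c ξ n) y
  · obtain ⟨y, -, hs⟩ := step_of_ringsNext (ι := ι) h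
    rw [hs]
    by_cases hxy : x = y
    · subst hxy; simp
    · simp [hxy]
  · rw [step_of_not_ringsNext h]

theorem ring_mono (hc : ∀ k, 0 ≤ c k) (x : Site d) : Monotone (ring c x) :=
  fun _ _ h => Finset.sum_le_sum_of_subset_of_nonneg (Finset.range_mono h) fun _ _ _ => hc _

/-- A local time does not exceed the next ring of its clock. -/
theorem localTime_mem_Icc (hc : ∀ k, 0 ≤ c k) (n : ℕ) (x : Site d) :
    (stateAfter ι c ξ n).localTime x ∈
      Set.Icc 0 (ring c x ((stateAfter ι c ξ n).odometer x + 1)) := by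
  induction n with
  | zero => exact ⟨le_rfl, Finset.sum_nonneg fun _ _ => hc _⟩
  | succ n ih =>
    rw [stateAfter_succ]
    by_cases h : ∃ y, RingsNext c (stateAfter ι c ξ n) y
    · obtain ⟨y, hy, hs⟩ := step_of_ringsNext (ι := ι) h
      rw [hs]
      refine ⟨add_nonneg ih.1 (by positivity), ?_⟩
      have hle : (stateAfter ι c ξ n).localTime x +
          (((stateAfter ι c ξ n).config x).numActive : ℝ) *
            (waiting c (stateAfter ι c ξ n) y).toReal ≤
          ring c x ((stateAfter ι c ξ n).odometer x + 1) := by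
        by_cases ha : ((stateAfter ι c ξ n).config x).numActive = 0
        · simpa [ha] using ih.2
        · have hpos : (0 : ℝ) < ((stateAfter ι c ξ n).config x).numActive := by
            exact_mod_cast Nat.pos_of_ne_zero ha
          -- The clock of `y` rings first, so that of `x` has not yet passed its next ring.
          have hw := hy.2 x
          rw [waiting.eq_def c _ x, if_neg ha] at hw
          have hw' := ENNReal.toReal_mono ENNReal.ofReal_ne_top hw
          rw [ENNReal.toReal_ofReal (div_nonneg (sub_nonneg.2 ih.2) hpos.le),
            le_div_iff₀ hpos] at hw'
          linarith
      refine hle.trans (ring_mono hc x (Nat.succ_le_succ ?_))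
      by_cases hxy : x = y
      · subst hxy; simp
      · simp [hxy]
    · rw [step_of_not_ringsNext h]
      exact ih

variable (ι c ξ) in
/-- The number of topplings before or at time `t`. -/
def toppleCount (t : ℝ≥0) : ℕ := sSup {n : ℕ | (stateAfter ι c ξ n).time ≤ (t : ℝ≥0∞)}

/-- Needed for the supremum in `toppleCount` to be a maximum: the supremum of an unbounded set of
naturals is 0 by convention. -/
theorem bddAbove_time_le {N : ℕ} (hN : ∀ α, Legal 1 ι α (ξ, 0) → α.length ≤ N) (t : ℝ≥0) :
    BddAbove {n : ℕ | (stateAfter ι c ξ n).time ≤ (t : ℝ≥0∞)} := by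
  refine ⟨N, fun n hn => ?_⟩
  obtain ⟨α, h₁, -, h₃⟩ := exists_legal_stateAfter ι c ξ n
  rw [← h₃ (ne_top_of_le_ne_top ENNReal.coe_ne_top hn)]
  exact hN α h₁

theorem time_toppleCount_le {N : ℕ} (hN : ∀ α, Legal 1 ι α (ξ, 0) → α.length ≤ N)
    (t : ℝ≥0) :
    (stateAfter ι c ξ (toppleCount ι c ξ t)).time ≤ (t : ℝ≥0∞) :=
  Nat.sSup_mem (s := {n : ℕ | (stateAfter ι c ξ n).time ≤ (t : ℝ≥0∞)}) ⟨0, bot_le (α := ℝ≥0∞)⟩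
    (bddAbove_time_le hN t)

theorem lt_time_toppleCount_succ {N : ℕ} (hN : ∀ α, Legal 1 ι α (ξ, 0) → α.length ≤ N)
    (t : ℝ≥0) :
    (t : ℝ≥0∞) < (stateAfter ι c ξ (toppleCount ι c ξ t + 1)).time := by
  by_contra! h
  have := le_csSup (bddAbove_time_le hN t) h
  exact absurd this (Nat.not_succ_le_self _)

theorem toppleCount_mono {N : ℕ} (hN : ∀ α, Legal 1 ι α (ξ, 0) → α.length ≤ N) :
    Monotone (toppleCount ι c ξ) := fun s t h =>
  le_csSup (bddAbove_time_le hN t) ((time_toppleCount_le hN s).trans (by exact_mod_cast h))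

/-- A site that is active is toppled before its local time is exhausted. -/
theorem odometer_lt_of_active {N : ℕ} (hN : ∀ α, Legal 1 ι α (ξ, 0) → α.length ≤ N)
    (hc : ∀ k, 0 ≤ c k) (hfin : {x | Reaches 1 ι ξ x 1}.Finite)
    {x : Site d} {L : ℝ} (hL : ∀ n, (stateAfter ι c ξ n).localTime x ≤ L) {s t : ℝ≥0}
    (hst : (s : ℝ) + L < t) (hs : 1 ≤ (finiteEvolution ι c ξ s x).numActive) :
    (stateAfter ι c ξ (toppleCount ι c ξ s)).odometer x <
      (stateAfter ι c ξ (toppleCount ι c ξ t)).odometer x := by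
  by_contra! hodo
  set a := toppleCount ι c ξ s with ha
  set b := toppleCount ι c ξ t with hb
  have hLnn : 0 ≤ L := (localTime_mem_Icc (ι := ι) (ξ := ξ) hc 0 x).1.trans (hL 0)
  have hab : a ≤ b := toppleCount_mono hN (by rw [← NNReal.coe_le_coe]; linarith)
  have hring : ∀ n, 1 ≤ ((stateAfter ι c ξ n).config x).numActive →
      ∃ y, RingsNext c (stateAfter ι c ξ n) y := fun n hn =>
    exists_ringsNext (hfin.subset fun y hy => reaches_one_of_active hy) hn
  -- As long as `x` itself is not toppled, the other topplings keep it active.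
  have hact : ∀ n, a ≤ n → n ≤ b → 1 ≤ ((stateAfter ι c ξ n).config x).numActive := by
    intro n han
    induction n, han using Nat.le_induction with
    | base => exact fun _ => hs
    | succ n han ih =>
      intro hnb
      have hn := ih (by omega)
      obtain ⟨y, -, hstep⟩ := step_of_ringsNext (ι := ι) (hring n hn)
      rw [← stateAfter_succ] at hstep
      have hyx : x ≠ y := by
        rintro rfl
        have h₁ : (stateAfter ι c ξ (n + 1)).odometer x = (stateAfter ι c ξ n).odometer x + 1 := by
          rw [hstep]; simp
        have h₂ := odometer_mono (ι := ι) (c := c) (ξ := ξ) x hnb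
        have h₃ := odometer_mono (ι := ι) (c := c) (ξ := ξ) x han
        simp only at h₂ h₃
        omega
      rw [hstep]
      exact hn.trans (numActive_le_topple hyx _ _)
  -- Local time at an active site runs at speed at least 1. Event `b + 1` is the first after `t`, so
  -- more than `L` of local time would have elapsed by then.
  have htime : ∀ n, a ≤ n → n ≤ b + 1 → (stateAfter ι c ξ n).time ≠ ⊤ ∧
      (stateAfter ι c ξ n).time.toReal - (stateAfter ι c ξ a).time.toReal ≤
        (stateAfter ι c ξ n).localTime x - (stateAfter ι c ξ a).localTime x := by
    intro n han
    induction n, han using Nat.le_induction with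
    | base =>
      exact fun _ => ⟨ne_top_of_le_ne_top ENNReal.coe_ne_top (time_toppleCount_le hN s), by simp⟩
    | succ n han ih =>
      intro hnb
      obtain ⟨h₁, h₂⟩ := ih (by omega)
      have hn := hact n han (by omega)
      obtain ⟨y, hy, hstep⟩ := step_of_ringsNext (ι := ι) (hring n hn)
      rw [stateAfter_succ, hstep]
      refine ⟨ENNReal.add_ne_top.2 ⟨h₁, hy.1⟩, ?_⟩
      simp only [ENNReal.toReal_add h₁ hy.1]
      have hn' : (1 : ℝ) ≤ ((stateAfter ι c ξ n).config x).numActive := by exact_mod_cast hn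
      have := mul_le_mul_of_nonneg_right hn'
        (ENNReal.toReal_nonneg (a := waiting c (stateAfter ι c ξ n) y))
      linarith
  obtain ⟨h₁, h₂⟩ := htime (b + 1) (by omega) le_rfl
  have h₃ := ENNReal.toReal_mono ENNReal.coe_ne_top (time_toppleCount_le (c := c) hN s)
  have h₄ := ENNReal.toReal_strict_mono h₁ (lt_time_toppleCount_succ (c := c) hN t)
  rw [ENNReal.coe_toReal] at h₃ h₄
  have h₅ := (localTime_mem_Icc (ι := ι) (ξ := ξ) hc a x).1
  have h₆ := hL (b + 1)
  linarith

theorem truncate_below (n : ℕ) (η : Config d) (x : Site d) : (truncate n η x).Below (η x) := by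
  unfold truncate
  split_ifs
  · exact ⟨le_rfl, le_rfl⟩
  · exact ⟨Nat.zero_le _, Nat.zero_le _⟩

theorem one_le_numActive_of_not_stable {a : Occ} (h : ¬ a.Stable) : 1 ≤ a.numActive := by
  by_contra h₀
  exact h (Occ.stable_of_numActive_eq_zero (by omega))

/-- The default value is vacant, hence stable, so an unstable value must be a genuine limit. -/
theorem exists_of_not_stable_eventualValue {α : Type*} {l : Filter α} {u : α → Occ}
    (h : ¬ (eventualValue l u).Stable) : ∃ v, ¬ v.Stable ∧ ∀ᶠ a in l, u a = v := by
  unfold eventualValue at h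
  split_ifs at h with hv
  · exact ⟨_, h, hv.choose_spec⟩
  · exact absurd (Or.inl rfl) h

/-- If each site is toppled finitely often, then the system fixates. -/
theorem fixates_of_not_reaches {ω : Sample d} (hc : ∀ k, 0 ≤ ω.2.2 k)
    (hfin : ∀ n, {x | Reaches 1 ω.2.1 (truncate n ω.1) x 1}.Finite)
    (hbd : ∀ x, ∃ n, ¬ Reaches 1 ω.2.1 ω.1 x n) : Fixates ω := by
  obtain ⟨η, ι, c⟩ := ω
  choose B hB using hbd
  have htrunc : ∀ (n : ℕ) (x : Site d) (m : ℕ), Reaches 1 ι (truncate n η) x m → m < B x := by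
    rintro n x m ⟨α, hα, hm⟩
    by_contra! hle
    exact hB x ⟨α, hα.of_below (fun _ => le_rfl) (truncate_below n η), hle.trans hm⟩
  have hlen : ∀ n : ℕ, ∃ N, ∀ α, Legal 1 ι α (truncate n η, 0) → α.length ≤ N := fun n =>
    ⟨∑ x ∈ (hfin n).toFinset, B x, fun α hα => length_le_of_count_le
      (fun x hx => (hfin n).mem_toFinset.2 ⟨α, hα, List.one_le_count_iff.2 hx⟩)
      fun x => (htrunc n x _ ⟨α, hα, le_rfl⟩).le⟩
  intro x
  by_contra! hnot
  -- In every truncated system `x` is toppled fewer than `B x` times, so its local time never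
  -- exceeds this ring.
  set L : ℝ≥0 := ⟨ring c x (B x), Finset.sum_nonneg fun _ _ => hc _⟩ with hL
  have hlocal : ∀ n k, (stateAfter ι c (truncate n η) k).localTime x ≤ (L : ℝ) := fun n k =>
    (localTime_mem_Icc hc k x).2.trans (ring_mono hc x (htrunc n x _ (reaches_odometer k x)))
  have hlate : ∀ T : ℝ≥0, ∃ s ≥ T, ∀ᶠ n in atTop,
      1 ≤ (finiteEvolution ι c (truncate n η) s x).numActive := by
    intro T
    obtain ⟨t, ht, hst⟩ := hnot T
    obtain ⟨v, hv, hev⟩ := exists_of_not_stable_eventualValue hst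
    obtain ⟨s, hs, hts⟩ := (hev.and self_mem_nhdsWithin).exists
    rw [← hs] at hv
    obtain ⟨w, hw, hev'⟩ := exists_of_not_stable_eventualValue hv
    refine ⟨s, ht.trans (le_of_lt hts), hev'.mono fun n hn => ?_⟩
    rw [hn]
    exact one_le_numActive_of_not_stable hw
  choose f hfT hf using hlate
  -- Times at which `x` is active in all large boxes; the extra 1 makes the gaps strictly longer
  -- than `L`.
  let t : ℕ → ℝ≥0 := fun i => Nat.rec (f 0) (fun _ s => f (s + L + 1)) i
  have ht : ∀ i, t i + L + 1 ≤ t (i + 1) := fun i => hfT _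
  have hact : ∀ i, ∀ᶠ n in atTop, 1 ≤ (finiteEvolution ι c (truncate n η) (t i) x).numActive := by
    intro i
    cases i with
    | zero => exact hf _
    | succ i => exact hf _
  -- One box serves the finitely many times `t 0, …, t (B x)`. Each gap forces a toppling of `x`,
  -- hence `B x` of them, one too many.
  obtain ⟨n, hn⟩ := ((Set.finite_Iic (B x)).eventually_all (p := fun i n =>
    1 ≤ (finiteEvolution ι c (truncate n η) (t i) x).numActive)).2 (fun i _ => hact i) |>.exists
  obtain ⟨N, hN⟩ := hlen n
  have hodo : ∀ i ≤ B x,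
      i ≤ (stateAfter ι c (truncate n η) (toppleCount ι c (truncate n η) (t i))).odometer x := by
    intro i
    induction i with
    | zero => exact fun _ => Nat.zero_le _
    | succ i ih =>
      intro hi
      refine Nat.succ_le_of_lt ((ih (by omega)).trans_lt ?_)
      refine odometer_lt_of_active hN hc (hfin n) (hlocal n) ?_ (hn i (Set.mem_Iic.2 (by omega)))
      have := NNReal.coe_le_coe.2 (ht i)
      push_cast at this
      linarith
  exact absurd (htrunc n x _ (reaches_odometer _ x)) (not_lt.2 (hodo _ le_rfl))

end Evolution

/-! ### Fixation at low density -/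

theorem ae_clock_nonneg (lam : ℝ≥0) :
    ∀ᵐ c ∂Measure.infinitePi fun _ : Site d × ℕ => clockLaw lam, ∀ k, 0 ≤ c k := by
  rw [ae_all_iff]
  intro k
  have h : ∀ᵐ x ∂clockLaw lam, 0 ≤ x := by
    have : clockLaw lam (Set.Iio 0) = 0 := by
      rw [clockLaw, expMeasure, gammaMeasure, withDensity_apply _ measurableSet_Iio]
      exact lintegral_gammaPDF_of_nonpos le_rfl
    rw [ae_iff]
    convert this using 2
    ext; simp
  exact (measurePreserving_eval_infinitePi (fun _ : Site d × ℕ => clockLaw lam)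
    k).quasiMeasurePreserving.ae h

theorem ae_finite_visited_truncate {p : PMF (Site d)} {lam : ℝ≥0} (hlam : 0 < lam) {z : Site d}
    (hz : z ∈ p.support) (hz₀ : z ≠ 0) (ν : Measure (Config d)) [IsProbabilityMeasure ν] (n : ℕ) :
    ∀ᵐ ω ∂ν.prod (stackLaw p lam), {x | Reaches 1 ω.2 (truncate n ω.1) x 1}.Finite := by
  have htr : Measurable (truncate n : Config d → Config d) := by
    refine measurable_pi_lambda _ fun x => ?_
    by_cases h : ∀ i, |x i| ≤ (n : ℤ)
    · simpa [truncate, h] using measurable_pi_apply x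
    · simp [truncate, h]
  have hmeas : MeasurableSet {ω : Config d × Stack d |
      {x | Reaches 1 ω.2 (truncate n ω.1) x 1}.Finite} := by
    have : {ω : Config d × Stack d | {x | Reaches 1 ω.2 (truncate n ω.1) x 1}.Finite} =
        ⋃ F : Finset (Site d), ⋂ x : Site d, ⋂ _ : x ∉ F,
          {ω | Reaches 1 ω.2 (truncate n ω.1) x 1}ᶜ := by
      ext ω
      simp only [Set.mem_iUnion, Set.mem_iInter, Set.mem_compl_iff]
      constructor
      · intro h
        have h' : {x | Reaches 1 ω.2 (truncate n ω.1) x 1}.Finite := h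
        exact ⟨h'.toFinset, fun x hx hr => hx (h'.mem_toFinset.2 hr)⟩
      · rintro ⟨F, hF⟩
        exact F.finite_toSet.subset fun x hx => by_contra fun hxF => hF x hxF hx
    rw [this]
    exact MeasurableSet.iUnion fun F => MeasurableSet.iInter fun x => MeasurableSet.iInter fun _ =>
      (measurableSet_reaches 1 measurable_snd (htr.comp measurable_fst) x 1).compl
  have hnull : ν.prod (stackLaw p lam) {ω : Config d × Stack d |
      {x | Reaches 1 ω.2 (truncate n ω.1) x 1}.Finite}ᶜ = 0 := by
    -- By Fubini it suffices to fix the initial configuration, whose truncation has finitely many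
    -- particles.
    rw [Measure.measure_prod_null hmeas.compl]
    refine Eventually.of_forall fun η => ?_
    refine measure_eq_zero_iff_ae_notMem.2 ?_
    filter_upwards [ae_finite_visited lam hlam hz hz₀ (η := truncate n η) (D := box d n)
      fun x hx => by rw [truncate, if_neg fun h => hx (mem_box.2 h)]; rfl] with ι hι h
    exact h hι
  filter_upwards [measure_eq_zero_iff_ae_notMem.1 hnull] with ω hω
  exact not_not.1 hω

theorem ae_fixates (hd : 0 < d) {p : PMF (Site d)} (hp : AddSubgroup.closure p.support = ⊤)
    {lam : ℝ≥0} (hlam : 0 < lam) {ν : Measure (Config d)} (hν : IsActiveInitialLaw ν)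
    (hdens : (density ν).toReal < (lam : ℝ) / (1 + (lam : ℝ))) :
    ∀ᵐ ω ∂sampleLaw p lam ν, Fixates ω := by
  have := hν.isProbabilityMeasure
  obtain ⟨z, hz, hz₀⟩ := exists_ne_zero_mem_support hd hp
  have hdens' : density ν < ((lam / (1 + lam) : ℝ≥0) : ℝ≥0∞) := by
    rw [← ENNReal.toReal_lt_toReal hν.density_ne_top ENNReal.coe_ne_top]
    rw [ENNReal.coe_toReal]
    exact_mod_cast hdens
  have h₁ := ae_exists_not_reaches lam hd hp hν.ergodic hν.density_ne_top hdens'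
  have h₂ := ae_all_iff.2 (ae_finite_visited_truncate (lam := lam) hlam hz hz₀ ν)
  have hproj : MeasurePreserving (fun ω : Sample d => (ω.1, ω.2.1)) (sampleLaw p lam ν)
      (ν.prod (stackLaw p lam)) :=
    (MeasurePreserving.id ν).prod measurePreserving_fst
  have h₃ : ∀ᵐ ω ∂sampleLaw p lam ν, ∀ k, 0 ≤ ω.2.2 k :=
    (Measure.quasiMeasurePreserving_snd.comp Measure.quasiMeasurePreserving_snd).ae
      (ae_clock_nonneg lam)
  filter_upwards [hproj.quasiMeasurePreserving.ae h₁, hproj.quasiMeasurePreserving.ae h₂, h₃]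
    with ω hω₁ hω₂ hω₃
  exact fixates_of_not_reaches hω₃ hω₂ hω₁

/-! ### Bernoulli initial configurations -/

/-- A single active particle with probability `q`, vacant otherwise. -/
def bernoulliOcc (q : ℝ≥0) : Measure Occ :=
  (1 - q) • Measure.dirac (Occ.active 0) + q • Measure.dirac (Occ.active 1)

theorem isProbabilityMeasure_bernoulliOcc {q : ℝ≥0} (hq : q ≤ 1) :
    IsProbabilityMeasure (bernoulliOcc q) := by
  constructor
  simp only [bernoulliOcc, Measure.add_apply, Measure.smul_apply, measure_univ, ENNReal.smul_def,
    smul_eq_mul, mul_one, ← ENNReal.coe_add, tsub_add_cancel_of_le hq, ENNReal.coe_one]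

/-- There are active initial laws of each density in `[0, 1]`. -/
theorem exists_isActiveInitialLaw (hd : 0 < d) {q : ℝ≥0} (hq : q ≤ 1) :
    ∃ ν : Measure (Config d), IsActiveInitialLaw ν ∧ density ν = q := by
  have := isProbabilityMeasure_bernoulliOcc hq
  set ν : Measure (Config d) := Measure.infinitePi fun _ : Site d => bernoulliOcc q with hν
  have heval : ∀ x : Site d, MeasurePreserving (fun η : Config d => η x) ν (bernoulliOcc q) :=
    measurePreserving_eval_infinitePi fun _ : Site d => bernoulliOcc q
  have hdens : density ν = q := by
    rw [density, (heval 0).lintegral_comp (f := fun a => (a.card : ℝ≥0∞))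
      (measurable_of_countable _), bernoulliOcc, lintegral_add_measure, lintegral_smul_measure,
      lintegral_smul_measure, lintegral_dirac, lintegral_dirac]
    simp [Occ.card, ENNReal.smul_def]
  refine ⟨ν, ⟨inferInstance, ⟨fun z => ?_, fun A hA hinv => ?_⟩, ?_, ?_⟩, hdens⟩
  · exact measurePreserving_comp (bernoulliOcc q) (add_left_injective z)
  -- Ergodicity of the product measure is the zero-one law with a one-point first factor.
  · have h := prod_infinitePi_zero_one (Z := Site d) (bernoulliOcc q) (Measure.dirac ())
      (S := fun _ => id) (fun _ => MeasurePreserving.id _)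
      (fun B _ _ => by
        rcases Set.eq_empty_or_nonempty B with rfl | ⟨u, hu⟩
        · simp
        · right
          simp [show () ∈ B from hu])
      (e := fun z x => x + z) (fun z => add_left_injective z)
      (fun F => by
        obtain ⟨z, hz⟩ := exists_disjoint_translate hd F
        refine ⟨z, Set.disjoint_left.2 ?_⟩
        rintro _ hk ⟨k, hk', rfl⟩
        exact hz k hk' hk)
      (A := Prod.snd ⁻¹' A) (measurable_snd hA) (fun z ω => by
        have := Set.ext_iff.1 (hinv z) ω.2
        exact this.symm)
    rwa [(measurePreserving_snd (μ := Measure.dirac ()) (ν := ν)).measure_preimage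
      hA.nullMeasurableSet] at h
  · rw [hdens]; exact ENNReal.coe_ne_top
  · rw [ae_all_iff]
    intro x
    refine (heval x).quasiMeasurePreserving.ae (p := fun a => a ≠ Occ.sleeping) ?_
    rw [ae_iff]
    simp [bernoulliOcc]

theorem Fixates.not_staysActive {ω : Sample d} (h : Fixates ω) : ¬ StaysActive ω := by
  intro hs
  obtain ⟨T, hT⟩ := h 0
  obtain ⟨t, ht, hact⟩ := hs 0 T
  rw [(hT t ht).numActive_eq_zero] at hact
  exact absurd hact (by norm_num)

end ARW

end

/-! ### The main theorem. -/

theorem theorem6p1 (d : ℕ) (hd : 0 < d) (p : PMF (ARW.Site d))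
    (hp : AddSubgroup.closure p.support = ⊤) (lam : ℝ≥0) (hlam : 0 < lam) :
    (∀ ζc : ℝ, ARW.IsCriticalDensity p lam ζc → (lam : ℝ) / (1 + (lam : ℝ)) ≤ ζc) ∧
    (∀ ν : Measure (ARW.Config d), ARW.IsActiveInitialLaw ν →
      (ARW.density ν).toReal < (lam : ℝ) / (1 + (lam : ℝ)) →
        ∀ᵐ ω ∂ARW.sampleLaw p lam ν, ARW.Fixates ω) := by
  refine ⟨fun ζc hζ => ?_, fun ν hν h => ARW.ae_fixates hd hp hlam hν h⟩
  by_contra! hlt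
  have hpos : (0 : ℝ) < (lam : ℝ) / (1 + (lam : ℝ)) := by positivity
  have hle : (lam : ℝ) / (1 + (lam : ℝ)) ≤ 1 := by
    rw [div_le_one (by positivity)]; linarith
  -- A density at which the system would both stay active and fixate. The maximum with 0 is needed
  -- as `ζc` could be negative, and `q ≤ 1` makes it a Bernoulli parameter.
  obtain ⟨q, hq₁, hq₂⟩ := exists_between (max_lt hlt hpos)
  have hq₀ : 0 ≤ q := (le_max_right _ _).trans hq₁.le
  obtain ⟨ν, hν, hdens⟩ := ARW.exists_isActiveInitialLaw hd (q := ⟨q, hq₀⟩)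
    (NNReal.coe_le_coe.1 (hq₂.le.trans hle))
  have hdens' : (ARW.density ν).toReal = q := by rw [hdens]; rfl
  have := hν.isProbabilityMeasure
  have h₁ := (hζ ν hν).2 (by rw [hdens']; exact (le_max_left _ _).trans_lt hq₁)
  have h₂ := ARW.ae_fixates hd hp hlam hν (by rw [hdens']; exact hq₂)
  have : IsProbabilityMeasure (ARW.sampleLaw p lam ν) := by
    unfold ARW.sampleLaw; infer_instance
  obtain ⟨ω, hω₁, hω₂⟩ := (h₁.and h₂).exists
  exact hω₂.not_staysActive hω₁
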